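/- **Notation.** $\mathbb N=\{0,1,2,\dots\}$; $2^{<\mathbb N}$ is the set of finite $0$-$1$ sequences, ordered by extension $\sqsubseteq$; $2^n$ is the set of those of length $n$; $2^{\mathbb N}$ is the Cantor set. For $\sigma\in2^{\mathbb N}$, $\sigma|n=(\sigma(0),\dots,\sigma(n-1))$; $t\sqsubset\sigma$ means that $t=\sigma|n$ for some $n$. For nodes $s,t$ write $s\prec t$ if $w^\smallfrown0\sqsubseteq s$ and $w^\smallfrown1\sqsubseteq t$ for some node $w$. *Equivalent families of functions.* Families $\{f_i\}_{i\in I}$ and $\{g_i\}_{i\in I}$ of real-valued functions on sets $S$ and $S'$ are equivalent if the map $f_i\mapsto g_i$ extends to a homeomorphism between the closure of $\{f_i\}_{i\in I}$ in $\mathbb R^{S}$ and the closure of $\{g_i\}_{i\in I}$ in $\mathbb R^{S'}$, both with the topology of pointwise convergence. *Canonical dense family of $2^{\leqslant\mathbb N}$.* Let $R=(s_t)_{t\in2^{<\mathbb N}}$ be a regular dyadic subtree of $2^{<\mathbb N}$, i.e. for all $t,t'$: $s_t\sqsubseteq s_{t'}\Leftrightarrow t\sqsubseteq t'$, $s_t\prec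 s_{t'}\Leftrightarrow t\prec t'$ and $|s_t|=|s_{t'}|\Leftrightarrow|t|=|t'|$. Suppose that $s^\smallfrown0^\infty\ne s'^\smallfrown0^\infty$ and $s^\smallfrown1^\infty\neq s'^\smallfrown1^\infty$ for all distinct $s,s'\in R$ (such $R$ exist). Identify $2^{\mathbb N}$ with the ternary Cantor set in $[0,1]$, and each point of it with the corresponding constant function on $2^{\mathbb N}$. The canonical dense family of $2^{\leqslant\mathbb N}$ (associated with $R$) is $\{s_t^\smallfrown0^\infty\}_{t\in2^{<\mathbb N}}$. *$C$-equivalent families of vectors.* Families $(x_i)_{i\in F}$ and $(z_i)_{i\in F}$ in two normed spaces are $C$-equivalent if $x_i\mapsto z_i$ defines a linear isomorphism $T$ from $\mathrm{span}\{x_i\}$ onto $\mathrm{span}\{z_i\}$ with $\|T\|\cdot\|T^{-1}\|\le C$. **Theorem.** Let $X$ be a real Banach space such that $X^*$ is separable and $X^{**}$ is non-separable, and let $\varepsilon>0$. Then there is a family $\{u_t\}_{t\in2^{<\mathbb N}}$ in the closed unit ball $B_X$ such that the following hold. (i) The family $\{u_t\}_{t\in2^{<\mathbb N}}$, regarded as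 a family of functions on $X^*$ (via $\phi\mapsto\phi(u_t)$), is equivalent to the canonical dense family of $2^{\leqslant\mathbb N}$ associated with $R$, for every $R$ as above. (ii) For every $\sigma\in2^{\mathbb N}$ the sequence $(u_{\sigma|n})_n$ is weak* convergent in $X^{**}$; denoting its limit by $y^{**}_\sigma$, for every $\sigma$ there is $y^{***}_\sigma\in X^{***}$ with $\|y^{***}_\sigma\|\le1+\varepsilon$, $y^{***}_\sigma(y^{**}_\sigma)=1$ and $y^{***}_\sigma(y^{**}_\tau)=0$ for all $\tau\ne\sigma$. (iii) For every $n\ge1$ and every choice of $\sigma_t\in2^{\mathbb N}$ with $t\sqsubset\sigma_t$, $t\in2^n$, the family $(y^{**}_{\sigma_t})_{t\in2^n}$ is $(1+\frac1n)$-equivalent to $(u_t)_{t\in2^n}$. -/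

import Mathlib

set_option maxSynthPendingDepth 4

open Filter Topology

/-! ## The Cantor tree

Nodes of the Cantor tree `2^{<ℕ}` are lists of booleans (`false = 0`, `true = 1`), elements of the
Cantor set `2^ℕ` are functions `ℕ → Bool`, and the level `2^n` is `List.Vector Bool n`.
The extension order `⊑` is the prefix relation `<+:` on lists. -/

namespace CantorTree

/-- The restriction `σ|n = (σ(0), …, σ(n-1))` of a branch `σ`. -/
def restrict (σ : ℕ → Bool) (n : ℕ) : List Bool := List.ofFn (fun i : Fin n => σ i)

/-- The infinite sequence `t⌢b^∞`. -/
def extendBy (b : Bool) (t : List Bool) : ℕ → Bool := fun i => t.getD i b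

/-- The relation `s ≺ t`: there is a node `w` with `w⌢0 ⊑ s` and `w⌢1 ⊑ t`. -/
def LexLT (s t : List Bool) : Prop :=
  ∃ w : List Bool, w ++ [false] <+: s ∧ w ++ [true] <+: t

/-- `s` enumerates a regular dyadic subtree `R = (s_t)` of the Cantor tree: it preserves and
reflects extension and the relation `≺`, and maps levels into levels. -/
structure IsRegularDyadic (s : List Bool → List Bool) : Prop where
  length_eq_iff : ∀ t t', (s t).length = (s t').length ↔ t.length = t'.length
  prefix_iff : ∀ t t', s t <+: s t' ↔ t <+: t'
  lex_iff : ∀ t t', LexLT (s t) (s t') ↔ LexLT t t'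

/-- For distinct nodes `s, s'` of `R` one has `s⌢0^∞ ≠ s'⌢0^∞` and `s⌢1^∞ ≠ s'⌢1^∞`. -/
def SeparatesTails (s : List Bool → List Bool) : Prop :=
  ∀ b : Bool, Function.Injective (fun t => extendBy b (s t))

/-- The canonical dense family `{s_t⌢0^∞}` of the space `2^{≤ℕ}` associated with
`R = (s_t)`. Here `σ ∈ 2^ℕ` is identified with the constant function on `2^ℕ` whose value is
the point of the (ternary) Cantor subset of `[0,1]` corresponding to `σ`. -/
noncomputable def canonicalFamily (s : List Bool → List Bool) (t : List Bool) :
    (ℕ → Bool) → ℝ :=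
  fun _ => (cantorSetHomeomorphNatToBool.symm (extendBy false (s t)) : ℝ)

end CantorTree

/-- Families `f`, `g` of real functions on `X` and `Y` are equivalent: the map `f i ↦ g i`
extends to a homeomorphism of the closures of the families in the topologies of pointwise
convergence. -/
def FamilyEquivalent {I X Y : Type*} (f : I → X → ℝ) (g : I → Y → ℝ) : Prop :=
  ∃ Φ : closure (Set.range f) ≃ₜ closure (Set.range g),
    ∀ i, Φ ⟨f i, subset_closure ⟨i, rfl⟩⟩ = ⟨g i, subset_closure ⟨i, rfl⟩⟩

/-- `(x i)` and `(y i)` are `C`-equivalent: `x i ↦ y i` defines a linear isomorphism `T` between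
the linear spans with `‖T‖ ‖T⁻¹‖ ≤ C`. -/
def BasicEquivalent {ι E F : Type*} [NormedAddCommGroup E] [NormedSpace ℝ E]
    [NormedAddCommGroup F] [NormedSpace ℝ F] (C : ℝ) (x : ι → E) (y : ι → F) : Prop :=
  ∃ T : Submodule.span ℝ (Set.range x) ≃L[ℝ] Submodule.span ℝ (Set.range y),
    (∀ i, T ⟨x i, Submodule.subset_span ⟨i, rfl⟩⟩ = ⟨y i, Submodule.subset_span ⟨i, rfl⟩⟩) ∧
    ‖(T : Submodule.span ℝ (Set.range x) →L[ℝ] Submodule.span ℝ (Set.range y))‖ *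
      ‖(T.symm : Submodule.span ℝ (Set.range y) →L[ℝ] Submodule.span ℝ (Set.range x))‖ ≤ C

/-! ## Regular dyadic subtrees with separated tails exist -/

namespace CantorTree

theorem lexLT_nil_left (t) : ¬ LexLT [] t := by rintro ⟨w, h, -⟩; simp at h
theorem lexLT_nil_right (t) : ¬ LexLT t [] := by rintro ⟨w, -, h⟩; simp at h
theorem lexLT_cons (a b s t) :
    LexLT (a :: s) (b :: t) ↔ (a = false ∧ b = true) ∨ (a = b ∧ LexLT s t) := by
  constructor
  · rintro ⟨w, h1, h2⟩
    cases w with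
    | nil => simp at h1 h2; simp [← h1, ← h2]
    | cons c w =>
      simp only [List.cons_append, List.cons_prefix_cons] at h1 h2
      exact Or.inr ⟨h1.1.symm.trans h2.1, w, h1.2, h2.2⟩
  · rintro (⟨rfl, rfl⟩ | ⟨rfl, w, h1, h2⟩)
    · exact ⟨[], by simp, by simp⟩
    · exact ⟨a :: w, by simpa using h1, by simpa using h2⟩

/-- The tree in which every digit `b` is replaced by the block `b, 0, 1`. -/
def blockTree (t : List Bool) : List Bool := t.flatMap fun b => [b, false, true]

theorem isRegularDyadic_blockTree : IsRegularDyadic blockTree where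
  length_eq_iff t t' := by
    have h : ∀ t, (blockTree t).length = 3 * t.length := by
      intro t; induction t with
      | nil => rfl
      | cons a t ih => simp [blockTree] at ih ⊢ ; omega
    rw [h, h]; omega
  prefix_iff t t' := by
    induction t generalizing t' with
    | nil => simp [blockTree]
    | cons a t ih => cases t' with
      | nil => simp [blockTree]
      | cons b t' =>
        have := ih t'
        simp [blockTree, List.cons_prefix_cons] at this ⊢
        intro _; exact this
  lex_iff t t' := by
    induction t generalizing t' with
    | nil => simp [blockTree, lexLT_nil_left]
    | cons a t ih => cases t' with
      | nil => simp [blockTree, lexLT_nil_right]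
      | cons b t' =>
        have := ih t'
        simp [blockTree, lexLT_cons] at this ⊢
        rw [this]

theorem separatesTails_blockTree : SeparatesTails blockTree := by
  intro b t
  induction t with
  | nil =>
    intro t' h
    cases t' with
    | nil => rfl
    | cons a t' =>
      exfalso
      have h1 := congrFun h 1
      have h2 := congrFun h 2
      simp [blockTree, extendBy] at h1 h2; simp_all
  | cons c t ih =>
    intro t' h
    cases t' with
    | nil =>
      exfalso
      have h1 := congrFun h 1
      have h2 := congrFun h 2
      simp [blockTree, extendBy] at h1 h2; simp_all
    | cons a t' =>
      have h0 := congrFun h 0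
      simp [blockTree, extendBy] at h0
      subst h0
      rw [@ih t']
      funext i
      have := congrFun h (i+3)
      simpa [blockTree, extendBy] using this

end CantorTree

/-! Since `X**` is non-separable, its unit ball contains points far from the span of any countable
set. As `X*` is separable, balls of `X**` are weak* metrizable, and a Cantor–Bendixson argument
(`exists_isCompact_isLarge_inter`) yields a weak* compact `K`, in a ball of radius below 1, each of
whose nonempty relatively open subsets contains such far points.

A tree of weak* open sets `U t` meeting `K` is built level by level (`IsOpenTuple.exists_isLevel`).
Far points give, by Hahn–Banach and Helly, almost biorthogonal functionals `f t` in `X*`. Weak*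
lower semicontinuity of the norm makes `‖∑ a i • y i‖` almost independent of the choice of `y i` in
`U i ∩ K`, for finitely many `a` and hence, by a net, for all `a`. Local reflexivity replaces the `y
i` by vectors `u i` of `X` lying in the `U i`, which gives (iii).

Each branch `σ` determines a point of `K` in all `U (σ|n)`; a weak* cluster point in `X***` of the
`f (σ|n)` gives the functional in (ii). The sets shrink on a dense sequence of `X*`, so nodes and
branches together map continuously into the functions on `X*`. This map and the one given by the
canonical family are continuous injections of the same compact space, whence (i). -/

/-! ## Simultaneous approximation of finitely many elements of the bidual -/

section LocalReflexivity

variable {Y : Type*} [NormedAddCommGroup Y] [NormedSpace ℝ Y]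

theorem exists_norm_lt_mul_norm_le_apply (G : StrongDual ℝ Y) {p r : ℝ} (hp : 0 ≤ p) (hpr : p < r) :
    ∃ w : Y, ‖w‖ < r ∧ p * ‖G‖ ≤ G w := by
  rcases eq_or_lt_of_le hp with rfl | hp'
  · exact ⟨0, by simpa using hpr, by simp⟩
  rcases eq_or_ne G 0 with rfl | hG
  · exact ⟨0, by simp; linarith, by simp⟩
  have hr : 0 < r := hp.trans_lt hpr
  have hlt : p / r * ‖G‖ < ‖G‖ := by
    have : p / r < 1 := (div_lt_one hr).2 hpr
    have := norm_pos_iff.2 hG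
    nlinarith
  obtain ⟨v, hv1, hv2⟩ := G.exists_lt_apply_of_lt_opNorm hlt
  rw [Real.norm_eq_abs] at hv2
  have key : ∃ v : Y, ‖v‖ < 1 ∧ p / r * ‖G‖ < G v := by
    rcases abs_cases (G v) with ⟨h, -⟩ | ⟨h, -⟩
    · exact ⟨v, hv1, h ▸ hv2⟩
    · exact ⟨-v, by simpa using hv1, by rw [map_neg]; exact h ▸ hv2⟩
  obtain ⟨v, hv1, hv2⟩ := key
  refine ⟨r • v, ?_, ?_⟩
  · rw [norm_smul, Real.norm_of_nonneg hr.le]; nlinarith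
  · rw [map_smul, smul_eq_mul]
    have : p * ‖G‖ = r * (p / r * ‖G‖) := by field_simp
    rw [this]
    exact mul_le_mul_of_nonneg_left hv2.le hr.le

/-- A weak form of the principle of local reflexivity. -/
theorem exists_approx_of_bidual {ι κ : Type*} [Fintype ι] [Fintype κ]
    (x : ι → StrongDual ℝ (StrongDual ℝ Y)) (a : κ → ι → ℝ) (r : κ → ℝ)
    (hr : ∀ k, ‖∑ i, a k i • x i‖ < r k) (s : Finset (StrongDual ℝ Y)) {δ : ℝ} (hδ : 0 < δ) :
    ∃ u : ι → Y, (∀ k, ‖∑ i, a k i • u i‖ < r k) ∧ ∀ i, ∀ φ ∈ s, |φ (u i) - x i φ| < δ := by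
  classical
  by_contra hcon
  -- If no `u` works, the subspace of values of `L` misses the open convex box `O`, and Hahn–Banach
  -- separates them.
  let L : (ι → Y) →ₗ[ℝ] (κ → Y) × (ι × s → ℝ) :=
    { toFun := fun u => (fun k => ∑ i, a k i • u i, fun q => q.2.1 (u q.1))
      map_add' := by
        intro u v; ext <;> simp [smul_add, Finset.sum_add_distrib]
      map_smul' := by
        intro c u; ext <;> simp [Finset.smul_sum, smul_comm c] }
  let c₀ : ι × s → ℝ := fun q => x q.1 q.2.1
  let O : Set ((κ → Y) × (ι × s → ℝ)) :=
    (Set.pi Set.univ fun k => Metric.ball 0 (r k)) ×ˢ (Set.pi Set.univ fun q => Metric.ball (c₀ q) δ)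
  have hO : IsOpen O := (isOpen_set_pi Set.finite_univ fun _ _ => Metric.isOpen_ball).prod
    (isOpen_set_pi Set.finite_univ fun _ _ => Metric.isOpen_ball)
  have hOc : Convex ℝ O := by
    refine Convex.prod (convex_pi ?_) (convex_pi ?_) <;> exact fun _ _ => convex_ball _ _
  have hdisj : Disjoint O (LinearMap.range L : Set ((κ → Y) × (ι × s → ℝ))) := by
    rw [Set.disjoint_left]
    rintro _ ⟨h1, h2⟩ ⟨u, rfl⟩
    refine hcon ⟨u, fun k => ?_, fun i φ hφ => ?_⟩
    · simpa [L] using h1 k trivial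
    · simpa [L, Real.dist_eq] using h2 (i, ⟨φ, hφ⟩) trivial
  obtain ⟨Λ, v, h1, h2⟩ := geometric_hahn_banach_open hOc hO (LinearMap.range L).convex hdisj
  have hv : v ≤ 0 := by simpa using h2 0 (LinearMap.range L).zero_mem
  -- A functional bounded below on a subspace vanishes there.
  have hΛ : ∀ u, Λ (L u) = 0 := by
    intro u
    by_contra hne
    have := h2 (L (((v - 1) / Λ (L u)) • u)) ⟨_, rfl⟩
    rw [map_smul, map_smul, smul_eq_mul, div_mul_cancel₀ _ hne] at this
    linarith
  have hr0 : ∀ k, 0 < r k := fun k => (norm_nonneg _).trans_lt (hr k)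
  let G : κ → StrongDual ℝ Y := fun k =>
    Λ.comp ((ContinuousLinearMap.inl ℝ (κ → Y) (ι × s → ℝ)).comp
      (ContinuousLinearMap.single ℝ (fun _ => Y) k))
  let l : ι × s → ℝ := fun q => Λ (0, Pi.single q 1)
  have hdec : ∀ w c, Λ (w, c) = ∑ k, G k (w k) + ∑ q, c q * l q := by
    intro w c
    have hw : w = ∑ k, Pi.single k (w k) := (Finset.univ_sum_single w).symm
    have hc : c = ∑ q, c q • (Pi.single q (1 : ℝ) : ι × s → ℝ) := pi_eq_sum_univ' c
    have : (w, c) = (ContinuousLinearMap.inl ℝ (κ → Y) (ι × s → ℝ)) w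
        + (ContinuousLinearMap.inr ℝ (κ → Y) (ι × s → ℝ)) c := by simp
    rw [this, map_add]
    congr 1
    · conv_lhs => rw [hw]
      simp only [map_sum]
      rfl
    · conv_lhs => rw [hc]
      simp only [map_sum, map_smul, smul_eq_mul]
      rfl
  have hzero : ∀ i, ∑ k, a k i • G k + ∑ φ : s, l (i, φ) • φ.1 = 0 := by
    intro i
    ext y
    have := hΛ (Pi.single i y)
    have hL : L (Pi.single i y) =
        (fun k => a k i • y, fun q => if q.1 = i then q.2.1 y else 0) := by
      ext q
      · simp [L, Pi.single_apply]
      · simp only [L, LinearMap.coe_mk, AddHom.coe_mk, Pi.single_apply]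
        split_ifs <;> simp
    rw [hL, hdec] at this
    rw [Fintype.sum_prod_type] at this
    simp only [map_smul, smul_eq_mul, ite_mul, zero_mul] at this
    rw [Finset.sum_eq_single i (by intro j _ hj; simp [hj]) (by simp)] at this
    simpa [sum_apply, mul_comm] using this
  -- Applying `x i` to the relation `hzero i` carries it to the bidual, where the value at the data
  -- of `x` is again zero.
  have hsum : ∑ k, (∑ i, a k i • x i) (G k) = - ∑ q, c₀ q * l q := by
    have : ∑ i, x i (∑ k, a k i • G k + ∑ φ : s, l (i, φ) • φ.1) = 0 :=
      Finset.sum_eq_zero fun i _ => by rw [hzero i, map_zero]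
    simp only [map_add, map_sum, map_smul, smul_eq_mul, Finset.sum_add_distrib] at this
    rw [Finset.sum_comm] at this
    rw [Fintype.sum_prod_type]
    simp only [sum_apply, smul_apply, smul_eq_mul, c₀]
    simp only [mul_comm (l _)] at this
    linarith
  -- These `w k` stay in the balls yet do at least as well as the bidual combinations, so `Λ (w, c₀)
  -- ≥ 0 ≥ v` although `(w, c₀)` lies in `O`.
  choose w hw1 hw2 using fun k =>
    exists_norm_lt_mul_norm_le_apply (G k) (norm_nonneg _) (hr k)
  have hmem : (w, c₀) ∈ O := ⟨fun k _ => by simpa using hw1 k, fun q _ => by simpa using hδ⟩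
  have hlt := h1 _ hmem
  rw [hdec] at hlt
  have hle : ∑ k, (∑ i, a k i • x i) (G k) ≤ ∑ k, G k (w k) :=
    Finset.sum_le_sum fun k _ =>
      ((le_abs_self _).trans ((∑ i, a k i • x i).le_opNorm (G k))).trans (hw2 k)
  linarith

/-- Helly's theorem, for elements of the bidual. -/
theorem exists_norm_lt_approx_of_bidual (x : StrongDual ℝ (StrongDual ℝ Y)) {r : ℝ} (hr : ‖x‖ < r)
    (s : Finset (StrongDual ℝ Y)) {δ : ℝ} (hδ : 0 < δ) :
    ∃ u : Y, ‖u‖ < r ∧ ∀ φ ∈ s, |φ u - x φ| < δ := by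
  obtain ⟨u, h1, h2⟩ := exists_approx_of_bidual (ι := Unit) (κ := Unit) (fun _ => x)
    (fun _ _ => 1) (fun _ => r) (by simpa using hr) s hδ
  exact ⟨u (), by simpa using h1 (), fun φ hφ => h2 () φ hφ⟩

/-- A vector at distance at least `θ` from a subspace is normalised by a functional of norm at most
`1 / θ` vanishing on the subspace. -/
theorem exists_dual_eq_one_of_le_norm_sub {S : Submodule ℝ Y} {x : Y} {θ : ℝ} (hθ : 0 < θ)
    (h : ∀ y ∈ S, θ ≤ ‖x - y‖) :
    ∃ z : StrongDual ℝ Y, ‖z‖ ≤ 1 / θ ∧ z x = 1 ∧ ∀ y ∈ S, z y = 0 := by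
  -- The functional is a norming functional of the class of `x` in the quotient by `S`, pulled back
  -- and rescaled.
  have hθx : θ ≤ ‖(Submodule.Quotient.mk x : Y ⧸ S)‖ := by
    refine le_of_forall_pos_le_add fun e he => ?_
    obtain ⟨m, hm, hlt⟩ := Submodule.Quotient.norm_mk_lt (S := S) (Submodule.Quotient.mk x) he
    have : x - m ∈ S := by
      rw [← Submodule.Quotient.eq]; exact hm.symm
    have := h _ this
    simp only [sub_sub_cancel] at this
    linarith
  have hx : 0 < ‖(Submodule.Quotient.mk x : Y ⧸ S)‖ := hθ.trans_le hθx
  obtain ⟨g, hg1, hg2⟩ := exists_dual_vector ℝ (Submodule.Quotient.mk x : Y ⧸ S) hx.ne'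
  have hb : ∀ y, ‖(g.toLinearMap ∘ₗ S.mkQ) y‖ ≤ 1 * ‖y‖ := fun y => by
    refine (g.le_opNorm _).trans ?_
    rw [hg1, one_mul, one_mul]
    exact Submodule.Quotient.norm_mk_le S y
  refine ⟨‖(Submodule.Quotient.mk x : Y ⧸ S)‖⁻¹ • (g.toLinearMap ∘ₗ S.mkQ).mkContinuous 1 hb,
    ?_, ?_, fun y hy => ?_⟩
  · rw [norm_smul, norm_inv, norm_norm, one_div]
    have h1 := LinearMap.mkContinuous_norm_le (g.toLinearMap ∘ₗ S.mkQ) zero_le_one hb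
    have h2 : ‖(Submodule.Quotient.mk x : Y ⧸ S)‖⁻¹ ≤ θ⁻¹ := inv_anti₀ hθ hθx
    calc _ ≤ ‖(Submodule.Quotient.mk x : Y ⧸ S)‖⁻¹ * 1 := by gcongr
      _ ≤ _ := by rwa [mul_one]
  · simp [hg2, hx.ne']
  · have : (Submodule.Quotient.mk y : Y ⧸ S) = 0 := (Submodule.Quotient.mk_eq_zero S).2 hy
    simp [this]

end LocalReflexivity

/-! ## A weak-star compact set all of whose relatively open subsets are large -/

section LargeSets

variable {E : Type*} [NormedAddCommGroup E] [NormedSpace ℝ E]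

/-- `V` contains elements at distance at least `θ` from the span of any given countable set. -/
def IsLarge (θ : ℝ) (V : Set (WeakDual ℝ E)) : Prop :=
  ∀ C : Set (StrongDual ℝ E), C.Countable →
    ∃ x ∈ V, ∀ y ∈ Submodule.span ℝ C, θ ≤ ‖WeakDual.toStrongDual x - y‖

/-- The closed span of a countable set is separable, hence proper, and Riesz's lemma applies with
ratio `θ / ρ < 1`. -/
theorem isLarge_closedBall (hns : ¬ TopologicalSpace.SeparableSpace (StrongDual ℝ E)) {θ ρ : ℝ}
    (hθ : 0 < θ) (hθρ : θ < ρ) :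
    IsLarge θ (WeakDual.toStrongDual ⁻¹' Metric.closedBall (0 : StrongDual ℝ E) ρ) := by
  intro C hC
  have hρ : 0 < ρ := hθ.trans hθρ
  have hne : ∃ x : StrongDual ℝ E, x ∉ (Submodule.span ℝ C).topologicalClosure := by
    by_contra! hall
    apply hns
    have hs := ((hC.isSeparable).span (R := ℝ)).closure
    rw [← Submodule.topologicalClosure_coe,
      (Submodule.eq_top_iff'.2 hall : (Submodule.span ℝ C).topologicalClosure = ⊤)] at hs
    exact TopologicalSpace.isSeparable_univ_iff.1 hs
  obtain ⟨x, -, hx1, hx⟩ := riesz_lemma_of_lt_one (Submodule.isClosed_topologicalClosure _) hne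
    ((div_lt_one hρ).2 hθρ)
  refine ⟨StrongDual.toWeakDual (ρ • x), ?_, fun y hy => ?_⟩
  · simp [norm_smul, hx1, abs_of_pos hρ]
  · have h1 := hx (ρ⁻¹ • y) (Submodule.le_topologicalClosure _ (Submodule.smul_mem _ _ hy))
    have h2 : ρ • x - y = ρ • (x - ρ⁻¹ • y) := by rw [smul_sub, smul_inv_smul₀ hρ.ne']
    change θ ≤ ‖ρ • x - y‖
    rw [h2, norm_smul, Real.norm_of_nonneg hρ.le]
    calc θ = ρ * (θ / ρ) := by field_simp
      _ ≤ _ := by gcongr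

/-- Delete from the ball every weak* open set whose trace is not large. The ball is compact
metrizable, so countably many deletions suffice, and a countable union of small sets cannot exhaust
a large one. -/
theorem exists_isCompact_isLarge_inter [TopologicalSpace.SeparableSpace E]
    (hns : ¬ TopologicalSpace.SeparableSpace (StrongDual ℝ E)) {θ ρ : ℝ}
    (hθ : 0 < θ) (hθρ : θ < ρ) :
    ∃ K : Set (WeakDual ℝ E), IsCompact K ∧ K.Nonempty ∧
      (∀ y ∈ K, ‖WeakDual.toStrongDual y‖ ≤ ρ) ∧
      ∀ U, IsOpen U → (U ∩ K).Nonempty → IsLarge θ (U ∩ K) := by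
  set B : Set (WeakDual ℝ E) :=
    WeakDual.toStrongDual ⁻¹' Metric.closedBall (0 : StrongDual ℝ E) ρ with hBdef
  have hB : IsCompact B := WeakDual.isCompact_closedBall _ _
  let ι := {U : Set (WeakDual ℝ E) // IsOpen U ∧ ¬ IsLarge θ (U ∩ B)}
  let K : Set (WeakDual ℝ E) := B \ ⋃ i : ι, i.1
  have key : ∀ V ⊆ B, IsLarge θ V → IsLarge θ (V ∩ K) := by
    intro V hVB hV C hC
    have := WeakDual.metrizable_of_isCompact ℝ E B hB
    have : CompactSpace B := isCompact_iff_compactSpace.1 hB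
    let := TopologicalSpace.metrizableSpaceMetric B
    obtain ⟨T, hT, hTU⟩ := TopologicalSpace.isOpen_iUnion_countable
      (fun i : ι => (Subtype.val ⁻¹' i.1 : Set B)) fun i => i.2.1.preimage continuous_subtype_val
    have hsmall : ∀ i : ι, ∃ C : Set (StrongDual ℝ E), C.Countable ∧
        ∀ x ∈ i.1 ∩ B, ∃ y ∈ Submodule.span ℝ C, ‖WeakDual.toStrongDual x - y‖ < θ := by
      intro i
      have := i.2.2
      unfold IsLarge at this
      push Not at this
      exact this
    choose D hD hDs using hsmall
    -- A point far from the span of `C` and of all the witnesses `D i` together avoids every deleted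
    -- set.
    obtain ⟨x, hxV, hx⟩ := hV (C ∪ ⋃ i ∈ T, D i) (hC.union (hT.biUnion fun i _ => hD i))
    refine ⟨x, ⟨hxV, hVB hxV, fun hxU => ?_⟩,
      fun y hy => hx y (Submodule.span_mono Set.subset_union_left hy)⟩
    have hx' : (⟨x, hVB hxV⟩ : B) ∈ ⋃ i : ι, (Subtype.val ⁻¹' i.1 : Set B) := by
      simpa using hxU
    rw [← hTU] at hx'
    simp only [Set.mem_iUnion] at hx'
    obtain ⟨i, hiT, hi⟩ := hx'
    obtain ⟨y, hy, hlt⟩ := hDs i x ⟨hi, hVB hxV⟩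
    refine (hx y (Submodule.span_mono ?_ hy)).not_gt hlt
    exact (Set.subset_biUnion_of_mem hiT).trans Set.subset_union_right
  refine ⟨K, hB.diff (isOpen_iUnion fun i => i.2.1), ?_, fun y hy => by simpa [B] using hy.1, ?_⟩
  · obtain ⟨x, hx, -⟩ := key B subset_rfl (isLarge_closedBall hns hθ hθρ) ∅ Set.countable_empty
    exact ⟨x, hx.2⟩
  · rintro U hU ⟨x, hxU, hxK⟩
    have h1 : IsLarge θ (U ∩ B) := by
      by_contra hnot
      exact hxK.2 (Set.mem_iUnion.2 ⟨⟨U, hU, hnot⟩, hxU⟩)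
    have h2 := key _ Set.inter_subset_right h1
    intro C hC
    obtain ⟨y, hy, hy'⟩ := h2 C hC
    exact ⟨y, ⟨hy.1.1, hy.2⟩, hy'⟩

end LargeSets

/-! ## Equivalence of finite families of vectors -/

section FiniteFamilies

variable {ι F G : Type*} [Fintype ι] [NormedAddCommGroup F] [NormedSpace ℝ F]
  [NormedAddCommGroup G] [NormedSpace ℝ G]

theorem linearIndependent_of_norm_le {x : ι → F} {c : ℝ}
    (h : ∀ a : ι → ℝ, ‖a‖ ≤ c * ‖∑ i, a i • x i‖) : LinearIndependent ℝ x := by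
  rw [Fintype.linearIndependent_iff]
  intro a ha i
  have := h a
  rw [ha, norm_zero, mul_zero] at this
  exact congrFun (norm_le_zero_iff.1 this) i

/-- The bounds with `c` only provide linear independence; `α` and `β` control the isomorphism and
its inverse. -/
theorem basicEquivalent_of_norm_le {x : ι → F} {y : ι → G} {c α β C : ℝ} (hα : 0 ≤ α) (hβ : 0 ≤ β)
    (hx : ∀ a : ι → ℝ, ‖a‖ ≤ c * ‖∑ i, a i • x i‖)
    (hy : ∀ a : ι → ℝ, ‖a‖ ≤ c * ‖∑ i, a i • y i‖)
    (hxy : ∀ a : ι → ℝ, ‖∑ i, a i • y i‖ ≤ α * ‖∑ i, a i • x i‖)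
    (hyx : ∀ a : ι → ℝ, ‖∑ i, a i • x i‖ ≤ β * ‖∑ i, a i • y i‖) (hC : α * β ≤ C) :
    BasicEquivalent C x y := by
  have hlx := linearIndependent_of_norm_le hx
  have hly := linearIndependent_of_norm_le hy
  obtain ⟨bx, hbx⟩ : ∃ b : Module.Basis ι ℝ (Submodule.span ℝ (Set.range x)),
      ∀ i, b i = ⟨x i, Submodule.subset_span ⟨i, rfl⟩⟩ :=
    ⟨Module.Basis.span hlx, fun i => Module.Basis.span_apply hlx i⟩
  obtain ⟨e, hby⟩ : ∃ b : Module.Basis ι ℝ (Submodule.span ℝ (Set.range y)),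
      ∀ i, b i = ⟨y i, Submodule.subset_span ⟨i, rfl⟩⟩ :=
    ⟨Module.Basis.span hly, fun i => Module.Basis.span_apply hly i⟩
  let T₀ := bx.equiv e (Equiv.refl ι)
  have hT₀ : ∀ i, T₀ (bx i) = e i := fun i => by
    rw [Module.Basis.equiv_apply, Equiv.refl_apply]
  have hT₀' : ∀ i, T₀.symm (e i) = bx i := fun i => by
    rw [LinearEquiv.symm_apply_eq, hT₀]
  have nx : ∀ a : ι → ℝ, ‖∑ i, a i • bx i‖ = ‖∑ i, a i • x i‖ := fun a => by
    simp only [Submodule.coe_norm, Submodule.coe_sum, Submodule.coe_smul, hbx]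
  have ny : ∀ a : ι → ℝ, ‖∑ i, a i • e i‖ = ‖∑ i, a i • y i‖ := fun a => by
    simp only [Submodule.coe_norm, Submodule.coe_sum, Submodule.coe_smul, hby]
  have h1 : ∀ v, ‖T₀ v‖ ≤ α * ‖v‖ := fun v => by
    have := hxy (bx.repr v)
    rw [← nx, ← ny, bx.sum_repr] at this
    conv_lhs => rw [← bx.sum_repr v]
    simpa only [map_sum, map_smul, hT₀] using this
  have h2 : ∀ v, ‖T₀.symm v‖ ≤ β * ‖v‖ := fun v => by
    have := hyx (e.repr v)
    rw [← nx, ← ny, e.sum_repr] at this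
    conv_lhs => rw [← e.sum_repr v]
    simpa only [map_sum, map_smul, hT₀'] using this
  refine ⟨T₀.toContinuousLinearEquivOfBounds α β h1 h2, fun i => ?_, ?_⟩
  · rw [← hbx, ← hby]
    exact hT₀ i
  · refine le_trans (mul_le_mul ?_ ?_ (norm_nonneg _) hα) hC
    · exact ContinuousLinearMap.opNorm_le_bound _ hα h1
    · exact ContinuousLinearMap.opNorm_le_bound _ hβ h2

theorem norm_sum_smul_le_card {x : ι → F} (hx : ∀ i, ‖x i‖ ≤ 1) (a : ι → ℝ) :
    ‖∑ i, a i • x i‖ ≤ Fintype.card ι * ‖a‖ := by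
  calc ‖∑ i, a i • x i‖ ≤ ∑ i, ‖a i • x i‖ := norm_sum_le _ _
    _ ≤ ∑ _i : ι, ‖a‖ := Finset.sum_le_sum fun i _ => by
        rw [norm_smul]
        exact (mul_le_of_le_one_right (norm_nonneg _) (hx i)).trans (norm_le_pi_norm a i)
    _ = _ := by simp

/-- Both norms are `card ι`-Lipschitz in the coefficients, so passing to a net point costs `card ι *
δ` on each side; homogeneity removes the restriction to the unit ball. -/
theorem norm_sum_smul_le_of_net {x : ι → F} {y : ι → G} {δ : ℝ}
    (hx : ∀ i, ‖x i‖ ≤ 1) (hy : ∀ i, ‖y i‖ ≤ 1) {T : Set (ι → ℝ)}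
    (hT : Metric.closedBall (0 : ι → ℝ) 1 ⊆ ⋃ b ∈ T, Metric.ball b δ)
    (hxy : ∀ b ∈ T, ‖∑ i, b i • x i‖ ≤ ‖∑ i, b i • y i‖ + 2 * δ) (a : ι → ℝ) :
    ‖∑ i, a i • x i‖ ≤ ‖∑ i, a i • y i‖ + (2 + 2 * Fintype.card ι) * δ * ‖a‖ := by
  rcases eq_or_ne a 0 with rfl | ha
  · simp
  have ha0 : 0 < ‖a‖ := norm_pos_iff.2 ha
  have h1 : ∀ a : ι → ℝ, ‖a‖ ≤ 1 →
      ‖∑ i, a i • x i‖ ≤ ‖∑ i, a i • y i‖ + (2 + 2 * Fintype.card ι) * δ := by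
    intro a ha
    obtain ⟨b, hb, hab⟩ : ∃ b ∈ T, a ∈ Metric.ball b δ := by
      simpa using hT (by simpa using ha : a ∈ Metric.closedBall 0 1)
    rw [mem_ball_iff_norm] at hab
    have e1 : ∑ i, a i • x i = ∑ i, b i • x i + ∑ i, (a - b) i • x i := by
      simp [sub_smul]
    have e2 : ∑ i, b i • y i = ∑ i, a i • y i - ∑ i, (a - b) i • y i := by
      simp [sub_smul]
    have n1 := norm_sum_smul_le_card hx (a - b)
    have n2 := norm_sum_smul_le_card hy (a - b)
    have n3 := norm_add_le (∑ i, b i • x i) (∑ i, (a - b) i • x i)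
    have n4 := norm_sub_le (∑ i, a i • y i) (∑ i, (a - b) i • y i)
    rw [← e1] at n3
    rw [← e2] at n4
    have n5 := hxy b hb
    have n6 : (Fintype.card ι : ℝ) * ‖a - b‖ ≤ Fintype.card ι * δ := by gcongr
    linarith
  have h2 := h1 (‖a‖⁻¹ • a) (by rw [norm_smul, norm_inv, norm_norm, inv_mul_cancel₀ ha0.ne'])
  simp only [Pi.smul_apply, smul_assoc, ← Finset.smul_sum, norm_smul, norm_inv, norm_norm] at h2
  have h3 := mul_le_mul_of_nonneg_left h2 ha0.le
  rw [mul_add, mul_inv_cancel_left₀ ha0.ne', mul_inv_cancel_left₀ ha0.ne'] at h3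
  linarith

/-- Evaluating the combination at `f i` recovers `a i` up to `‖a‖ / 2`, which is absorbed on the
left. -/
theorem norm_le_of_almost_biorthogonal [DecidableEq ι] {y : ι → StrongDual ℝ F} {f : ι → F}
    {R η : ℝ} (hf : ∀ i, ‖f i‖ ≤ R)
    (hyf : ∀ i j, |y j (f i) - if i = j then 1 else 0| ≤ η) (hη : Fintype.card ι * η ≤ 1 / 2)
    (a : ι → ℝ) : ‖a‖ ≤ 2 * R * ‖∑ j, a j • y j‖ := by
  rcases isEmpty_or_nonempty ι with hι | ⟨⟨i₀⟩⟩
  · simp [Subsingleton.elim a 0]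
  have hR : 0 ≤ R := (norm_nonneg _).trans (hf i₀)
  have h : ‖a‖ ≤ R * ‖∑ j, a j • y j‖ + ‖a‖ / 2 := by
    refine (pi_norm_le_iff_of_nonneg (by positivity)).2 fun i => ?_
    have h1 : ‖(∑ j, a j • y j) (f i)‖ ≤ R * ‖∑ j, a j • y j‖ := by
      refine ((∑ j, a j • y j).le_opNorm (f i)).trans ?_
      rw [mul_comm]
      gcongr
      exact hf i
    have h2 : a i = (∑ j, a j • y j) (f i)
        - ∑ j, a j * (y j (f i) - if i = j then 1 else 0) := by
      simp [mul_sub, Finset.sum_sub_distrib, sum_apply]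
    have h3 : ‖∑ j, a j * (y j (f i) - if i = j then 1 else 0)‖ ≤ ‖a‖ / 2 := by
      calc _ ≤ ∑ j, ‖a j * (y j (f i) - if i = j then 1 else 0)‖ := norm_sum_le _ _
        _ ≤ ∑ _j : ι, ‖a‖ * η := Finset.sum_le_sum fun j _ => by
            rw [norm_mul]
            exact mul_le_mul (norm_le_pi_norm a j) (hyf i j) (norm_nonneg _) (norm_nonneg _)
        _ = ‖a‖ * (Fintype.card ι * η) := by simp; ring
        _ ≤ ‖a‖ * (1 / 2) := by gcongr
        _ = _ := by ring
    rw [h2]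
    exact (norm_sub_le _ _).trans (add_le_add h1 h3)
  linarith

end FiniteFamilies

/-! ## Refining finite tuples of weak-star open sets -/

section Refinement

/-- A tuple of open sets each of which meets `K`. -/
def IsOpenTuple {ι W : Type*} [TopologicalSpace W] (K : Set W) (U : ι → Set W) : Prop :=
  ∀ i, IsOpen (U i) ∧ (U i ∩ K).Nonempty

/-- Dense hereditary conditions are imposed one at a time: later shrinking preserves those already
met. -/
theorem IsOpenTuple.exists_forall_refinement {ι κ W : Type*} [TopologicalSpace W] {K : Set W}
    [Finite κ] (P : κ → (ι → Set W) → Prop)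
    (hered : ∀ k U U', U' ≤ U → P k U → P k U')
    (dense : ∀ k U, IsOpenTuple K U → ∃ U' ≤ U, IsOpenTuple K U' ∧ P k U')
    {U : ι → Set W} (hU : IsOpenTuple K U) : ∃ U' ≤ U, IsOpenTuple K U' ∧ ∀ k, P k U' := by
  classical
  have := Fintype.ofFinite κ
  suffices h : ∀ s : Finset κ, ∃ U' ≤ U, IsOpenTuple K U' ∧ ∀ k ∈ s, P k U' by
    simpa using h Finset.univ
  intro s
  induction s using Finset.induction_on with
  | empty => exact ⟨U, le_rfl, hU, by simp⟩
  | insert k s _ ih =>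
    obtain ⟨U₁, h1, h2, h3⟩ := ih
    obtain ⟨U₂, h4, h5, h6⟩ := dense k U₁ h2
    refine ⟨U₂, h4.trans h1, h5, fun l hl => ?_⟩
    rcases Finset.mem_insert.1 hl with rfl | hl
    · exact h6
    · exact hered l _ _ h4 (h3 l hl)

variable {ι E : Type*} [NormedAddCommGroup E] [NormedSpace ℝ E]

/-- Largeness moves the `i`-th point away from the span of the others. A functional in the next dual
is 1 at it and 0 at the others; Helly's theorem replaces it by some `f` in `E`, and evaluation at
`f` is weak* continuous. -/
theorem IsOpenTuple.exists_almost_biorthogonal [Finite ι] [DecidableEq ι] {K : Set (WeakDual ℝ E)}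
    {θ R : ℝ} (hθ : 0 < θ) (hR : 1 / θ < R)
    (hK : ∀ U, IsOpen U → (U ∩ K).Nonempty → IsLarge θ (U ∩ K)) {η : ℝ} (hη : 0 < η) (i : ι)
    {U : ι → Set (WeakDual ℝ E)} (hU : IsOpenTuple K U) :
    ∃ U' ≤ U, IsOpenTuple K U' ∧ ∃ f : E, ‖f‖ ≤ R ∧
      ∀ j, ∀ y ∈ U' j, |y f - if i = j then 1 else 0| < η := by
  classical
  have := Fintype.ofFinite ι
  choose x hx using fun j => (hU j).2
  obtain ⟨xi, hxi, hxd⟩ := hK (U i) (hU i).1 (hU i).2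
    ((fun j => WeakDual.toStrongDual (x j)) '' {j | j ≠ i}) (Set.toFinite _).countable
  obtain ⟨z, hz1, hz2, hz3⟩ := exists_dual_eq_one_of_le_norm_sub hθ hxd
  obtain ⟨f, hf1, hf2⟩ := exists_norm_lt_approx_of_bidual z (hz1.trans_lt hR)
    (Finset.univ.image fun j => WeakDual.toStrongDual (Function.update x i xi j)) hη
  refine ⟨fun j => U j ∩ {y | |y f - if i = j then 1 else 0| < η},
    fun j => Set.inter_subset_left, fun j => ⟨(hU j).1.inter ?_, ?_⟩, f, hf1.le,
    fun j y hy => hy.2⟩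
  · exact isOpen_lt (((WeakDual.eval_continuous f).sub continuous_const).abs) continuous_const
  · have h := hf2 _ (Finset.mem_image_of_mem _ (Finset.mem_univ j))
    rcases eq_or_ne j i with rfl | hji
    · rw [Function.update_self, hz2] at h
      exact ⟨xi, ⟨hxi.1, by simpa using h⟩, hxi.2⟩
    · rw [Function.update_of_ne hji, hz3 _ (Submodule.subset_span ⟨j, hji, rfl⟩)] at h
      exact ⟨x j, ⟨(hx j).1, by simpa [hji.symm] using h⟩, (hx j).2⟩

/-- Take `M` to be the supremum of the norms over `K`. By weak* lower semicontinuity a nearly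
maximal value persists on a neighbourhood. The lower bound is not confined to `K`, so it applies
also to vectors of `X`. -/
theorem IsOpenTuple.exists_almost_constant_norm [Fintype ι] {K : Set (WeakDual ℝ E)}
    (hK : ∀ y ∈ K, ‖WeakDual.toStrongDual y‖ ≤ 1) {δ : ℝ} (hδ : 0 < δ) (a : ι → ℝ)
    {U : ι → Set (WeakDual ℝ E)} (hU : IsOpenTuple K U) :
    ∃ U' ≤ U, IsOpenTuple K U' ∧ ∃ M : ℝ,
      (∀ y : ι → WeakDual ℝ E, (∀ i, y i ∈ U' i) →
        M - δ ≤ ‖∑ i, a i • WeakDual.toStrongDual (y i)‖) ∧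
      ∀ y : ι → WeakDual ℝ E, (∀ i, y i ∈ U' i ∩ K) →
        ‖∑ i, a i • WeakDual.toStrongDual (y i)‖ ≤ M := by
  let N : (ι → WeakDual ℝ E) → ℝ := fun y => ‖∑ i, a i • WeakDual.toStrongDual (y i)‖
  let S : Set ℝ := N '' {y | ∀ i, y i ∈ U i ∩ K}
  have hbdd : BddAbove S := by
    refine ⟨Fintype.card ι * ‖a‖, ?_⟩
    rintro _ ⟨y, hy, rfl⟩
    exact norm_sum_smul_le_card (fun i => hK _ (hy i).2) a
  choose x₀ hx₀ using fun j => (hU j).2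
  obtain ⟨_, ⟨x, hx, rfl⟩, hxM⟩ := exists_lt_of_lt_csSup (s := S) ⟨_, x₀, hx₀, rfl⟩
    (sub_lt_self (sSup S) hδ)
  -- One `φ` in the unit ball nearly norms the combination; this is a weak* open condition on the
  -- whole tuple.
  have hφ : ∃ φ : E, ‖φ‖ < 1 ∧
      sSup S - δ < |(∑ i, a i • WeakDual.toStrongDual (x i)) φ| := by
    simpa only [Real.norm_eq_abs] using
      ContinuousLinearMap.exists_lt_apply_of_lt_opNorm _ hxM
  obtain ⟨φ, hφ1, hφ2⟩ := hφ
  let O : Set (ι → WeakDual ℝ E) := {y | sSup S - δ < |∑ i, a i * y i φ|}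
  have hO : IsOpen O := by
    refine isOpen_lt continuous_const (Continuous.abs ?_)
    exact continuous_finsetSum _ fun i _ => continuous_const.mul
      ((WeakDual.eval_continuous φ).comp (continuous_apply i))
  have hxO : x ∈ O := by
    simpa [O, sum_apply] using hφ2
  obtain ⟨u, hu, huO⟩ := isOpen_pi_iff'.1 hO x hxO
  refine ⟨fun i => U i ∩ u i, fun i => Set.inter_subset_left,
    fun i => ⟨(hU i).1.inter (hu i).1, x i, ⟨(hx i).1, (hu i).2⟩, (hx i).2⟩, sSup S,
    fun y hy => ?_, fun y hy => ?_⟩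
  · have h1 : sSup S - δ < |∑ i, a i * y i φ| := huO fun i _ => (hy i).2
    refine h1.le.trans ?_
    have h2 := (∑ i, a i • WeakDual.toStrongDual (y i)).le_opNorm φ
    have h3 : |∑ i, a i * y i φ| ≤ ‖∑ i, a i • WeakDual.toStrongDual (y i)‖ * ‖φ‖ := by
      simpa [sum_apply] using h2
    exact h3.trans (mul_le_of_le_one_right (norm_nonneg _) hφ1.le)
  · exact le_csSup hbdd ⟨y, fun i => ⟨(hy i).1.1, (hy i).2⟩, rfl⟩

theorem WeakDual.exists_finset_of_isOpen {U : Set (WeakDual ℝ E)} (hU : IsOpen U)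
    {x : WeakDual ℝ E} (hx : x ∈ U) :
    ∃ (s : Finset E) (δ : ℝ), 0 < δ ∧
      ∀ y : WeakDual ℝ E, (∀ φ ∈ s, |y φ - x φ| < δ) → y ∈ U := by
  obtain ⟨s, r, hr, h⟩ := (WeakDual.withSeminorms (𝕜 := ℝ) (E := E)).mem_nhds_iff x U |>.1
    (hU.mem_nhds hx)
  refine ⟨s, r, hr, fun y hy => h ?_⟩
  rw [Seminorm.ball_finset_sup_eq_iInter _ _ _ hr]
  simp only [Set.mem_iInter, Seminorm.mem_ball]
  exact fun φ hφ => hy φ hφ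

end Refinement

/-! ### Construction of one level of the tree -/

section Level

variable {X : Type*} [NormedAddCommGroup X] [NormedSpace ℝ X]

/-- The canonical embedding of `X` into its bidual with the weak-star topology. -/
noncomputable def weakStarEmbedding (x : X) : WeakDual ℝ (StrongDual ℝ X) :=
  StrongDual.toWeakDual (NormedSpace.inclusionInDoubleDual ℝ X x)

theorem norm_sum_smul_weakStarEmbedding {ι : Type*} [Fintype ι] (a : ι → ℝ) (u : ι → X) :
    ‖∑ i, a i • WeakDual.toStrongDual (weakStarEmbedding (u i))‖ = ‖∑ i, a i • u i‖ := by
  rw [← (NormedSpace.inclusionInDoubleDualLi (E := X) ℝ).norm_map (∑ i, a i • u i)]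
  simp only [map_sum, map_smul]
  rfl

/-- The data attached to a finite level of the tree: open sets `U i` meeting `K`, almost
biorthogonal functionals `f i`, and vectors `u i` of `X` in `U i` almost equivalent to every choice
of elements of `U i ∩ K`. -/
structure IsLevel {ι : Type*} [DecidableEq ι] (K : Set (WeakDual ℝ (StrongDual ℝ X))) (R η : ℝ)
    (Φ : Finset (StrongDual ℝ X)) (V U : ι → Set (WeakDual ℝ (StrongDual ℝ X)))
    (f : ι → StrongDual ℝ X) (u : ι → X) : Prop where
  isOpenTuple : IsOpenTuple K U
  closure_subset : ∀ i, closure (U i) ⊆ V i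
  norm_functional_le : ∀ i, ‖f i‖ ≤ R
  biorthogonal : ∀ i j, ∀ y ∈ U j, |y (f i) - if i = j then 1 else 0| < η
  norm_vector_le : ∀ i, ‖u i‖ ≤ 1
  embedding_mem : ∀ i, weakStarEmbedding (u i) ∈ U i
  oscillation : ∀ i, ∀ φ ∈ Φ, ∀ y ∈ U i, ∀ y' ∈ U i, |y φ - y' φ| < η
  equivalent : ∀ y : ι → WeakDual ℝ (StrongDual ℝ X), (∀ i, y i ∈ U i ∩ K) →
    ∀ C, 1 + η ≤ C → BasicEquivalent C (fun i => WeakDual.toStrongDual (y i)) u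

theorem IsOpenTuple.exists_isLevel {ι : Type*} [Fintype ι] [DecidableEq ι]
    {K : Set (WeakDual ℝ (StrongDual ℝ X))} {θ R ρ : ℝ} (hθ : 0 < θ) (hR : 1 / θ < R) (hρ : ρ < 1)
    (hKρ : ∀ y ∈ K, ‖WeakDual.toStrongDual y‖ ≤ ρ)
    (hK : ∀ U, IsOpen U → (U ∩ K).Nonempty → IsLarge θ (U ∩ K)) {η : ℝ} (hη : 0 < η)
    (Φ : Finset (StrongDual ℝ X)) {V : ι → Set (WeakDual ℝ (StrongDual ℝ X))}
    (hV : IsOpenTuple K V) : ∃ U f u, IsLevel K R η Φ V U f u := by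
  classical
  have hR0 : 0 < R := (by positivity : 0 < 1 / θ).trans hR
  have hK1 : ∀ y ∈ K, ‖WeakDual.toStrongDual y‖ ≤ 1 := fun y hy => (hKρ y hy).trans hρ.le
  set n : ℝ := (Fintype.card ι : ℝ) with hn
  have hn0 : 0 ≤ n := Nat.cast_nonneg _
  obtain ⟨η₀, hη₀, hη₀η, hη₀n⟩ : ∃ η₀ : ℝ, 0 < η₀ ∧ η₀ ≤ η ∧ n * η₀ ≤ 1 / 2 := by
    refine ⟨min η (1 / (2 * (n + 1))), by positivity, min_le_left _ _, ?_⟩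
    calc n * min η (1 / (2 * (n + 1))) ≤ (n + 1) * (1 / (2 * (n + 1))) := by
          gcongr
          · linarith
          · exact min_le_right _ _
      _ = 1 / 2 := by field_simp
  -- Each direction of the equivalence will cost a factor `1 + η₁`.
  obtain ⟨η₁, hη₁, hη₁η⟩ : ∃ η₁ : ℝ, 0 < η₁ ∧ (1 + η₁) * (1 + η₁) ≤ 1 + η := by
    refine ⟨min η 1 / 3, by positivity, ?_⟩
    have h1 : 0 < min η 1 := by positivity
    have h2 := min_le_left η 1
    have h3 := min_le_right η 1
    nlinarith
  -- The first bound keeps the `u i` in the unit ball, as `ρ + δ ≤ 1`; the second turns the additive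
  -- net error into the factor `1 + η₁`.
  obtain ⟨δ, hδ, hδρ, hδη⟩ : ∃ δ : ℝ, 0 < δ ∧ δ ≤ 1 - ρ ∧ (2 + 2 * n) * δ * (2 * R) ≤ η₁ := by
    refine ⟨min (1 - ρ) (η₁ / ((2 + 2 * n) * (2 * R))),
      lt_min (sub_pos.2 hρ) (by positivity), min_le_left _ _, ?_⟩
    calc (2 + 2 * n) * min (1 - ρ) (η₁ / ((2 + 2 * n) * (2 * R))) * (2 * R)
        ≤ (2 + 2 * n) * (η₁ / ((2 + 2 * n) * (2 * R))) * (2 * R) := by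
          gcongr
          exact min_le_right _ _
      _ = η₁ := by field_simp
  -- small sets with closures inside `V i`
  obtain ⟨U₀, hU₀, hU₀V, hU₀Φ⟩ : ∃ U₀ : ι → Set (WeakDual ℝ (StrongDual ℝ X)),
      IsOpenTuple K U₀ ∧ (∀ i, closure (U₀ i) ⊆ V i) ∧
      ∀ i, ∀ φ ∈ Φ, ∀ y ∈ U₀ i, ∀ y' ∈ U₀ i, |y φ - y' φ| < η := by
    choose x hx using fun i => (hV i).2
    choose O hO using fun i => exists_mem_nhds_isClosed_subset ((hV i).1.mem_nhds (hx i).1)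
    refine ⟨fun i => interior (O i) ∩ ⋂ φ ∈ Φ, {y | |y φ - x i φ| < η / 2}, fun i => ⟨?_, ?_⟩,
      fun i => ?_, fun i φ hφ y hy y' hy' => ?_⟩
    · refine isOpen_interior.inter (isOpen_biInter_finset fun φ _ => ?_)
      exact isOpen_lt (((WeakDual.eval_continuous φ).sub continuous_const).abs) continuous_const
    · refine ⟨x i, ⟨mem_interior_iff_mem_nhds.2 (hO i).1, ?_⟩, (hx i).2⟩
      simpa using fun _ _ => hη
    · refine (closure_minimal ?_ (hO i).2.1).trans (hO i).2.2
      exact Set.inter_subset_left.trans interior_subset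
    · have h1 := Set.mem_iInter₂.1 hy.2 φ hφ
      have h2 := Set.mem_iInter₂.1 hy'.2 φ hφ
      simp only [Set.mem_ofPred_eq, abs_lt] at h1 h2 ⊢
      constructor <;> linarith
  obtain ⟨U₁, hU₁₀, hU₁, hU₁f⟩ := hU₀.exists_forall_refinement (κ := ι)
    (fun i U => ∃ f : StrongDual ℝ X, ‖f‖ ≤ R ∧
      ∀ j, ∀ y ∈ U j, |y f - if i = j then 1 else 0| < η₀)
    (fun i U U' hle ⟨f, h1, h2⟩ => ⟨f, h1, fun j y hy => h2 j y (hle j hy)⟩)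
    (fun i U hU => hU.exists_almost_biorthogonal hθ hR hK hη₀ i)
  choose f hfR hf using hU₁f
  obtain ⟨T₀, hT₀, hT₀c⟩ := Metric.totallyBounded_iff.1
    (isCompact_closedBall (0 : ι → ℝ) 1).totallyBounded δ hδ
  -- The unit coordinate vectors join the net so that the norm of each single `u i` is controlled.
  let T : Set (ι → ℝ) := T₀ ∪ Set.range fun i => Pi.single i 1
  have hT : T.Finite := hT₀.union (Set.finite_range _)
  have := hT.fintype
  obtain ⟨U, hU₂₁, hU, hUM⟩ := hU₁.exists_forall_refinement (κ := T)
    (fun a U => ∃ M : ℝ,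
      (∀ y : ι → WeakDual ℝ (StrongDual ℝ X), (∀ i, y i ∈ U i) →
        M - δ ≤ ‖∑ i, a.1 i • WeakDual.toStrongDual (y i)‖) ∧
      ∀ y : ι → WeakDual ℝ (StrongDual ℝ X), (∀ i, y i ∈ U i ∩ K) →
        ‖∑ i, a.1 i • WeakDual.toStrongDual (y i)‖ ≤ M)
    (fun a U U' hle ⟨M, h1, h2⟩ => ⟨M, fun y hy => h1 y fun i => hle i (hy i),
      fun y hy => h2 y fun i => ⟨hle i (hy i).1, (hy i).2⟩⟩)
    (fun a U hU => hU.exists_almost_constant_norm hK1 hδ a.1)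
  choose M hM₁ hM₂ using hUM
  choose x hx using fun i => (hU i).2
  choose s d hd hs using fun i => WeakDual.exists_finset_of_isOpen (hU i).1 (hx i).1
  obtain ⟨d₀, hd₀, hd₀pos⟩ : ∃ d₀ : ℝ, (∀ i, d₀ ∈ Set.Ioo 0 (d i)) ∧ 0 < d₀ :=
    ((eventually_all.2 fun i => Ioo_mem_nhdsGT (hd i)).and self_mem_nhdsWithin :
      ∀ᶠ e in 𝓝[>] (0 : ℝ), (∀ i, e ∈ Set.Ioo 0 (d i)) ∧ 0 < e).exists
  obtain ⟨u, hu₁, hu₂⟩ := exists_approx_of_bidual (fun i => WeakDual.toStrongDual (x i))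
    (fun a : T => a.1) (fun a => ‖∑ i, a.1 i • WeakDual.toStrongDual (x i)‖ + δ)
    (fun a => lt_add_of_pos_right _ hδ) (Finset.univ.biUnion s) hd₀pos
  have huU : ∀ i, weakStarEmbedding (u i) ∈ U i := fun i => hs i _ fun φ hφ =>
    (hu₂ i φ (Finset.mem_biUnion.2 ⟨i, Finset.mem_univ i, hφ⟩)).trans (hd₀ i).2
  have hun : ∀ i, ‖u i‖ ≤ 1 := fun i => by
    have h1 := hu₁ ⟨Pi.single i 1, Or.inr ⟨i, rfl⟩⟩
    simp only [Pi.single_apply, ite_smul, one_smul, zero_smul, Finset.sum_ite_eq',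
      Finset.mem_univ, if_true] at h1
    have h2 := hKρ _ (hx i).2
    linarith
  have hfU : ∀ i j, ∀ y ∈ U j, |y (f i) - if i = j then 1 else 0| < η₀ :=
    fun i j y hy => hf i j y (hU₂₁ j hy)
  refine ⟨U, f, u, hU, fun i => (closure_mono ((hU₂₁.trans hU₁₀) i)).trans (hU₀V i), hfR,
    fun i j y hy => (hfU i j y hy).trans_le hη₀η, hun, huU,
    fun i φ hφ y hy y' hy' => hU₀Φ i φ hφ y ((hU₂₁.trans hU₁₀) i hy) y'
      ((hU₂₁.trans hU₁₀) i hy'), fun y hy C hC => ?_⟩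
  have hly := norm_le_of_almost_biorthogonal (y := fun i => WeakDual.toStrongDual (y i)) hfR
    (fun i j => (hfU i j _ (hy j).1).le) hη₀n
  have hlu := norm_le_of_almost_biorthogonal
    (y := fun i => WeakDual.toStrongDual (weakStarEmbedding (u i))) hfR
    (fun i j => (hfU i j _ (huU j)).le) hη₀n
  simp only [norm_sum_smul_weakStarEmbedding] at hlu
  have hTc : Metric.closedBall (0 : ι → ℝ) 1 ⊆ ⋃ b ∈ T, Metric.ball b δ :=
    hT₀c.trans (Set.biUnion_subset_biUnion_left Set.subset_union_left)
  have hy1 : ∀ i, ‖WeakDual.toStrongDual (y i)‖ ≤ 1 := fun i => hK1 _ (hy i).2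
  have hyu := norm_sum_smul_le_of_net hy1 hun hTc fun b hb => by
    have h1 := hM₂ ⟨b, hb⟩ y hy
    have h2 := hM₁ ⟨b, hb⟩ _ huU
    rw [norm_sum_smul_weakStarEmbedding] at h2
    linarith
  -- On the net, `u` exceeds `x` by less than `δ`, `x` is at most `M`, and `M` exceeds `y` by at
  -- most `δ`: hence the `2 * δ`.
  have huy := norm_sum_smul_le_of_net hun hy1 hTc fun b hb => by
    have h1 := hM₁ ⟨b, hb⟩ y fun i => (hy i).1
    have h2 := hM₂ ⟨b, hb⟩ x hx
    have h3 := hu₁ ⟨b, hb⟩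
    simp only at h1 h2 h3
    linarith
  -- Almost biorthogonality bounds the coefficients by the norm of the combination, so the additive
  -- error becomes relative.
  have key : ∀ p q N : ℝ, 0 ≤ q → p ≤ q + (2 + 2 * n) * δ * N → N ≤ 2 * R * q →
      p ≤ (1 + η₁) * q := by
    intro p q N hq h1 h2
    have h3 : (2 + 2 * n) * δ * N ≤ (2 + 2 * n) * δ * (2 * R * q) := by gcongr
    have h4 : (2 + 2 * n) * δ * (2 * R) * q ≤ η₁ * q := by gcongr
    linarith
  exact basicEquivalent_of_norm_le (by positivity) (by positivity) hly hlu
    (fun a => key _ _ _ (norm_nonneg _) (huy a) (hly a))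
    (fun a => key _ _ _ (norm_nonneg _) (hyu a) (hlu a)) (hη₁η.trans hC)

end Level

/-! ## The compact space of nodes and branches of the Cantor tree -/

theorem closure_range_comp_of_denseRange {Q I Y : Type*} [TopologicalSpace Q] [CompactSpace Q]
    [TopologicalSpace Y] [T2Space Y] {j : I → Q} (hj : DenseRange j) {F : Q → Y}
    (hF : Continuous F) : closure (Set.range fun i => F (j i)) = Set.range F := by
  refine Set.Subset.antisymm (closure_minimal ?_ (isCompact_range hF).isClosed) ?_
  · rintro _ ⟨i, rfl⟩
    exact ⟨j i, rfl⟩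
  · have := hF.range_subset_closure_image_dense hj
    rwa [← Set.range_comp] at this

/-- Continuous injections of a compact space into Hausdorff spaces are embeddings, and by density
their ranges are the two closures. -/
theorem familyEquivalent_of_compactSpace {Q I A B : Type*} [TopologicalSpace Q] [CompactSpace Q]
    {j : I → Q} (hj : DenseRange j) {F : Q → A → ℝ} {G : Q → B → ℝ}
    (hF : Continuous F) (hF' : Function.Injective F) (hG : Continuous G)
    (hG' : Function.Injective G) :
    FamilyEquivalent (fun i => F (j i)) (fun i => G (j i)) := by
  have eF := (hF.isClosedEmbedding hF').isEmbedding
  have eG := (hG.isClosedEmbedding hG').isEmbedding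
  refine ⟨(Homeomorph.setCongr (closure_range_comp_of_denseRange hj hF)).trans (eF.toHomeomorph.symm.trans
    (eG.toHomeomorph.trans (Homeomorph.setCongr (closure_range_comp_of_denseRange hj hG)).symm)), fun i => ?_⟩
  have h1 : eF.toHomeomorph.symm ⟨F (j i), j i, rfl⟩ = j i := by
    rw [Homeomorph.symm_apply_eq]; rfl
  apply Subtype.ext
  change G (eF.toHomeomorph.symm ⟨F (j i), j i, rfl⟩) = _
  rw [h1]

namespace CantorTree

@[simp]
theorem length_restrict (σ : ℕ → Bool) (n : ℕ) : (restrict σ n).length = n := by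
  simp [restrict]

theorem getElem?_restrict (σ : ℕ → Bool) (n i : ℕ) :
    (restrict σ n)[i]? = if i < n then some (σ i) else none := by
  simp only [restrict, List.getElem?_ofFn]
  split_ifs <;> rfl

theorem restrict_succ (σ : ℕ → Bool) (n : ℕ) : restrict σ (n + 1) = restrict σ n ++ [σ n] := by
  rw [restrict, List.ofFn_succ_last]; rfl

theorem restrict_prefix (σ : ℕ → Bool) {m n : ℕ} (h : m ≤ n) : restrict σ m <+: restrict σ n := by
  induction n, h using Nat.le_induction with
  | base => exact List.prefix_rfl
  | succ n _ ih => exact ih.trans ⟨[σ n], (restrict_succ σ n).symm⟩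

theorem restrict_prefix_iff {σ : ℕ → Bool} {n : ℕ} {t : List Bool} :
    restrict σ n <+: t ↔ ∀ i < n, t[i]? = some (σ i) := by
  rw [List.prefix_iff_getElem?]
  simp only [length_restrict]
  refine forall₂_congr fun i hi => ?_
  simp [restrict]

theorem restrict_injective {σ τ : ℕ → Bool} (h : ∀ n, restrict σ n = restrict τ n) : σ = τ := by
  funext i
  have : (restrict σ (i + 1))[i]? = (restrict τ (i + 1))[i]? := by rw [h]
  rw [getElem?_restrict, getElem?_restrict, if_pos i.lt_succ_self, if_pos i.lt_succ_self] at this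
  exact Option.some_injective _ this

/-- `none` stands for the positions past the end of a node. -/
instance : TopologicalSpace (Option Bool) := ⊥

instance : DiscreteTopology (Option Bool) := ⟨rfl⟩

/-- The nodes and the branches of the Cantor tree. -/
inductive Completion where
  | node (t : List Bool)
  | branch (σ : ℕ → Bool)

namespace Completion

/-- The sequence of digits of a node or a branch. -/
def digits : Completion → ℕ → Option Bool
  | node t => fun i => t[i]?
  | branch σ => fun i => some (σ i)

instance : TopologicalSpace Completion := TopologicalSpace.induced digits inferInstance

@[simp]
theorem digits_node (t : List Bool) (i : ℕ) : (node t).digits i = t[i]? := rfl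

@[simp]
theorem digits_branch (σ : ℕ → Bool) (i : ℕ) : (branch σ).digits i = some (σ i) := rfl

/-- This description exhibits the completion as a closed subset of a product of finite discrete
spaces, hence compact. -/
theorem range_digits :
    Set.range digits = {q : ℕ → Option Bool | ∀ n, q n = none → q (n + 1) = none} := by
  ext q
  constructor
  · rintro ⟨t | σ, rfl⟩ n hn
    · change t[n]? = none at hn
      change t[n + 1]? = none
      simp only [List.getElem?_eq_none_iff] at hn ⊢
      omega
    · exact absurd hn (by simp [digits])
  · intro hq
    by_cases h : ∃ n, q n = none
    · classical
      have hlt : ∀ i < Nat.find h, q i ≠ none := fun i hi => Nat.find_min h hi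
      have hge : ∀ i, Nat.find h ≤ i → q i = none := by
        intro i hi
        induction i, hi using Nat.le_induction with
        | base => exact Nat.find_spec h
        | succ i _ ih => exact hq i ih
      refine ⟨node (List.ofFn fun i : Fin (Nat.find h) => (q i).getD false), ?_⟩
      funext i
      rw [digits_node, List.getElem?_ofFn]
      split_ifs with hi
      · obtain ⟨b, hb⟩ := Option.ne_none_iff_exists'.1 (hlt i hi)
        simp [hb]
      · exact (hge i (not_lt.1 hi)).symm
    · push Not at h
      refine ⟨branch fun i => (q i).getD false, ?_⟩
      funext i
      obtain ⟨b, hb⟩ := Option.ne_none_iff_exists'.1 (h i)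
      simp [hb]

instance : CompactSpace Completion := by
  rw [← isCompact_univ_iff, (Topology.IsInducing.mk rfl : Topology.IsInducing digits).isCompact_iff,
    Set.image_univ, range_digits]
  refine IsClosed.isCompact ?_
  simp only [Set.ofPred_forall]
  refine isClosed_iInter fun n => ?_
  have h : IsOpen {q : ℕ → Option Bool | q n = none} :=
    (isOpen_discrete ({none} : Set (Option Bool))).preimage
      (continuous_apply (A := fun _ : ℕ => Option Bool) n)
  have h' : IsClosed {q : ℕ → Option Bool | q (n + 1) = none} :=
    (isClosed_discrete ({none} : Set (Option Bool))).preimage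
      (continuous_apply (A := fun _ : ℕ => Option Bool) (n + 1))
  exact isClosed_imp h h'

theorem setOf_digits_eq_mem_nhds (q : Completion) (n : ℕ) :
    {p : Completion | ∀ i < n, p.digits i = q.digits i} ∈ 𝓝 q := by
  rw [nhds_induced]
  refine ⟨Set.pi (Set.Iio n) fun i => {q.digits i},
    set_pi_mem_nhds (Set.finite_Iio n) fun i _ => by simp, fun p hp i hi => hp i hi⟩

theorem tendsto_node_restrict (σ : ℕ → Bool) :
    Tendsto (fun n => node (restrict σ n)) atTop (𝓝 (branch σ)) := by
  rw [nhds_induced, tendsto_comap_iff, tendsto_pi_nhds]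
  intro i
  refine tendsto_const_nhds.congr' ?_
  filter_upwards [eventually_gt_atTop i] with n hn
  change some (σ i) = (restrict σ n)[i]?
  rw [getElem?_restrict, if_pos hn]

theorem denseRange_node : DenseRange node := by
  rintro (t | σ)
  · exact subset_closure ⟨t, rfl⟩
  · exact mem_closure_of_tendsto (tendsto_node_restrict σ) (Eventually.of_forall fun n => ⟨_, rfl⟩)

/-- Nodes are isolated points, so continuity has to be checked at branches only. -/
theorem continuous_of_forall_branch {Y : Type*} [TopologicalSpace Y] {F : Completion → Y}
    (h : ∀ σ, ∀ O ∈ 𝓝 (F (branch σ)), ∃ n,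
      (∀ t, restrict σ n <+: t → F (node t) ∈ O) ∧
      ∀ τ, restrict τ n = restrict σ n → F (branch τ) ∈ O) : Continuous F := by
  rw [continuous_iff_continuousAt]
  rintro (t | σ) O hO
  · change ∀ᶠ p in 𝓝 (node t), F p ∈ O
    -- The extra position carries the first `none`, which rules out branches and longer nodes.
    filter_upwards [setOf_digits_eq_mem_nhds (node t) (t.length + 1)] with p hp
    have : p = node t := by
      rcases p with t' | τ
      · refine congrArg node (List.ext_getElem? fun i => ?_)
        rcases lt_or_ge i (t.length + 1) with hi | hi
        · exact hp i hi
        · have h1 : t'[t.length]? = t[t.length]? := hp _ (Nat.lt_succ_self _)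
          rw [List.getElem?_eq_none_iff.2 le_rfl, List.getElem?_eq_none_iff] at h1
          rw [List.getElem?_eq_none_iff.2 (by omega), List.getElem?_eq_none_iff.2 (by omega)]
      · have h1 : some (τ t.length) = t[t.length]? := hp _ (Nat.lt_succ_self _)
        simp at h1
    rw [this]
    exact mem_of_mem_nhds hO
  · obtain ⟨n, h1, h2⟩ := h σ O hO
    change ∀ᶠ p in 𝓝 (branch σ), F p ∈ O
    filter_upwards [setOf_digits_eq_mem_nhds (branch σ) n] with p hp
    rcases p with t | τ
    · exact h1 t (restrict_prefix_iff.2 hp)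
    · refine h2 τ (List.ext_getElem? fun i => ?_)
      rw [getElem?_restrict, getElem?_restrict]
      split_ifs with hi
      · exact hp i hi
      · rfl

end Completion

/-! ### The canonical family as a continuous injective image of the completion -/

theorem getD_eq_of_prefix {l l' : List Bool} (h : l <+: l') {i : ℕ} (hi : i < l.length) (b : Bool) :
    l'.getD i b = l.getD i b := by
  obtain ⟨r, rfl⟩ := h
  rw [List.getD_append _ _ _ _ hi]

theorem IsRegularDyadic.length_le {s : List Bool → List Bool} (hs : IsRegularDyadic s)
    (t : List Bool) : t.length ≤ (s t).length := by
  induction t using List.reverseRecOn with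
  | nil => simp
  | append_singleton t b ih =>
    have h1 := ((hs.prefix_iff t (t ++ [b])).2 ⟨[b], rfl⟩).length_le
    have h2 := (hs.length_eq_iff t (t ++ [b])).not.2 (by simp)
    rw [List.length_append, List.length_singleton]
    omega

/-- The limit branch of the nodes `s (σ|n)`. -/
def limitBranch (s : List Bool → List Bool) (σ : ℕ → Bool) : ℕ → Bool :=
  -- A node of level `i + 1` is sent to one of length at least `i + 1`, so the default digit is
  -- never read here.
  fun i => extendBy false (s (restrict σ (i + 1))) i

theorem IsRegularDyadic.limitBranch_apply {s : List Bool → List Bool} (hs : IsRegularDyadic s)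
    (σ : ℕ → Bool) {n i : ℕ} (hi : i < (s (restrict σ n)).length) :
    limitBranch s σ i = extendBy false (s (restrict σ n)) i := by
  have h1 : i < (s (restrict σ (i + 1))).length := by
    have := hs.length_le (restrict σ (i + 1))
    rw [length_restrict] at this
    omega
  rcases le_total n (i + 1) with h | h
  · exact getD_eq_of_prefix ((hs.prefix_iff _ _).2 (restrict_prefix σ h)) hi _
  · exact (getD_eq_of_prefix ((hs.prefix_iff _ _).2 (restrict_prefix σ h)) h1 _).symm

/-- The extension to the completion of the map `t ↦ s_t⌢0^∞`. -/
def canonicalMap (s : List Bool → List Bool) : Completion → ℕ → Bool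
  | .node t => extendBy false (s t)
  | .branch σ => limitBranch s σ

theorem IsRegularDyadic.continuous_canonicalMap {s : List Bool → List Bool}
    (hs : IsRegularDyadic s) : Continuous (canonicalMap s) := by
  refine continuous_pi fun i => Completion.continuous_of_forall_branch fun σ O hO => ?_
  have hO' := mem_of_mem_nhds hO
  have hlen : i < (s (restrict σ (i + 1))).length := by
    have := hs.length_le (restrict σ (i + 1))
    rw [length_restrict] at this
    omega
  refine ⟨i + 1, fun t ht => ?_, fun τ hτ => ?_⟩
  · have h1 : canonicalMap s (Completion.node t) i = canonicalMap s (Completion.branch σ) i :=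
      getD_eq_of_prefix ((hs.prefix_iff _ _).2 ht) hlen _
    rwa [h1]
  · have h1 : canonicalMap s (Completion.branch τ) i = canonicalMap s (Completion.branch σ) i :=
      congrArg (fun l => extendBy false (s l) i) hτ
    rwa [h1]

/-- Otherwise the limit branch is eventually zero, so for all large `n` the node `s (σ|n)` has the
same zero extension as `s t`; separation of tails then forces `σ|n = t` for two different `n`. -/
theorem IsRegularDyadic.extendBy_ne_limitBranch {s : List Bool → List Bool}
    (hs : IsRegularDyadic s) (hs' : SeparatesTails s) (t : List Bool) (σ : ℕ → Bool) :
    extendBy false (s t) ≠ limitBranch s σ := by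
  intro h
  have key : ∀ n, (s t).length ≤ n → restrict σ n = t := by
    intro n hn
    apply hs' false
    funext i
    change extendBy false (s (restrict σ n)) i = extendBy false (s t) i
    have hlen := hs.length_le (restrict σ n)
    rw [length_restrict] at hlen
    rcases lt_or_ge i (s (restrict σ n)).length with hi | hi
    · rw [h, hs.limitBranch_apply σ hi]
    · unfold extendBy
      rw [List.getD_eq_default _ _ hi, List.getD_eq_default _ _ (by omega)]
  have h1 := congrArg List.length (key _ le_rfl)
  have h2 := congrArg List.length (key _ (Nat.le_succ _))
  simp only [length_restrict] at h1 h2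
  omega

theorem IsRegularDyadic.injective_canonicalMap {s : List Bool → List Bool}
    (hs : IsRegularDyadic s) (hs' : SeparatesTails s) : Function.Injective (canonicalMap s) := by
  rintro (t | σ) (t' | τ) h
  · exact congrArg Completion.node (hs' false h)
  · exact absurd h (hs.extendBy_ne_limitBranch hs' t τ)
  · exact absurd h.symm (hs.extendBy_ne_limitBranch hs' t' σ)
  · refine congrArg Completion.branch (restrict_injective fun n => hs' false ?_)
    -- Images of one level have one length, so the limit branches determine them as prefixes.
    have hl : (s (restrict σ n)).length = (s (restrict τ n)).length :=
      (hs.length_eq_iff _ _).2 (by simp)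
    funext i
    change extendBy false (s (restrict σ n)) i = extendBy false (s (restrict τ n)) i
    rcases lt_or_ge i (s (restrict σ n)).length with hi | hi
    · rw [← hs.limitBranch_apply σ hi, ← hs.limitBranch_apply τ (hl ▸ hi)]
      exact congrFun h i
    · unfold extendBy
      rw [List.getD_eq_default _ _ hi, List.getD_eq_default _ _ (hl ▸ hi)]

theorem familyEquivalent_canonicalFamily {A : Type*} {F : Completion → A → ℝ} (hF : Continuous F)
    (hF' : Function.Injective F) {s : List Bool → List Bool} (hs : IsRegularDyadic s)
    (hs' : SeparatesTails s) :
    FamilyEquivalent (fun t => F (Completion.node t)) (canonicalFamily s) := by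
  refine familyEquivalent_of_compactSpace (G := fun q _ =>
    (cantorSetHomeomorphNatToBool.symm (canonicalMap s q) : ℝ)) Completion.denseRange_node hF hF'
    ?_ ?_
  · exact continuous_pi fun _ => continuous_subtype_val.comp
      (cantorSetHomeomorphNatToBool.symm.continuous.comp hs.continuous_canonicalMap)
  · intro p q h
    exact hs.injective_canonicalMap hs' (cantorSetHomeomorphNatToBool.symm.injective
      (Subtype.ext (congrFun h fun _ => false)))

end CantorTree

/-! ## The tree of weak-star open sets -/

section Tree

variable {X : Type*} [NormedAddCommGroup X] [NormedSpace ℝ X]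

/-- The families `U`, `f`, `u` indexed by the Cantor tree form a level in the sense of `IsLevel`
over each `2^n`, and the sets `U t` decrease along the tree, avoiding the previous vectors. -/
structure IsLevelTree (K : Set (WeakDual ℝ (StrongDual ℝ X))) (R : ℝ) (η : ℕ → ℝ)
    (Φ : ℕ → Finset (StrongDual ℝ X)) (U : List Bool → Set (WeakDual ℝ (StrongDual ℝ X)))
    (f : List Bool → StrongDual ℝ X) (u : List Bool → X) : Prop where
  isLevel : ∀ n, ∃ V, IsLevel K R (η n) (Φ n) V (fun t : List.Vector Bool n => U t.toList)
    (fun t => f t.toList) (fun t => u t.toList)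
  closure_subset : ∀ t b, closure (U (t ++ [b])) ⊆ U t \ {weakStarEmbedding (u t)}

theorem exists_isLevelTree {K : Set (WeakDual ℝ (StrongDual ℝ X))} {θ R ρ : ℝ} (hθ : 0 < θ)
    (hR : 1 / θ < R) (hρ : ρ < 1) (hK₀ : K.Nonempty)
    (hKρ : ∀ y ∈ K, ‖WeakDual.toStrongDual y‖ ≤ ρ)
    (hK : ∀ U, IsOpen U → (U ∩ K).Nonempty → IsLarge θ (U ∩ K)) {η : ℕ → ℝ} (hη : ∀ n, 0 < η n)
    (Φ : ℕ → Finset (StrongDual ℝ X)) : ∃ U f u, IsLevelTree K R η Φ U f u := by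
  let D := (List Bool → Set (WeakDual ℝ (StrongDual ℝ X))) × (List Bool → StrongDual ℝ X) ×
    (List Bool → X)
  let P : ℕ → (List Bool → Set (WeakDual ℝ (StrongDual ℝ X))) → D → Prop := fun n V S =>
    IsLevel K R (η n) (Φ n) (fun t : List.Vector Bool n => V t.toList)
      (fun t : List.Vector Bool n => S.1 t.toList) (fun t => S.2.1 t.toList)
      (fun t => S.2.2 t.toList)
  have step : ∀ n V, IsOpenTuple K (fun t : List.Vector Bool n => V t.toList) →
      ∃ S, P n V S := by
    intro n V hV
    obtain ⟨U, f, u, h⟩ := hV.exists_isLevel hθ hR hρ hKρ hK (hη n) (Φ n)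
    -- Values off level `n` are junk and are never read.
    refine ⟨⟨fun l => if h : l.length = n then U ⟨l, h⟩ else ∅,
      fun l => if h : l.length = n then f ⟨l, h⟩ else 0,
      fun l => if h : l.length = n then u ⟨l, h⟩ else 0⟩, ?_⟩
    have e : ∀ t : List.Vector Bool n, t.toList.length = n := fun t => t.toList_length
    have e' : ∀ t : List.Vector Bool n, (⟨t.toList, e t⟩ : List.Vector Bool n) = t := fun t => rfl
    simpa only [P, e, dite_true, e'] using h
  -- Both children start from the parent's set without the parent's vector; almost biorthogonality
  -- separates them later.
  let next : D → List Bool → Set (WeakDual ℝ (StrongDual ℝ X)) := fun S l =>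
    S.1 l.dropLast \ {weakStarEmbedding (S.2.2 l.dropLast)}
  have hnext : ∀ n V S, P n V S →
      IsOpenTuple K (fun t : List.Vector Bool (n + 1) => next S t.toList) := by
    intro n V S h t
    have hl : t.toList.dropLast.length = n := by simp
    have ho := h.isOpenTuple ⟨t.toList.dropLast, hl⟩
    refine ⟨ho.1.sdiff isClosed_singleton, ?_⟩
    -- Largeness supplies a point of `K` at distance at least `θ` from the removed vector.
    obtain ⟨x, hx, hxd⟩ := hK _ ho.1 ho.2
      {WeakDual.toStrongDual (weakStarEmbedding (S.2.2 t.toList.dropLast))}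
      (Set.countable_singleton _)
    refine ⟨x, ⟨hx.1, ?_⟩, hx.2⟩
    rintro rfl
    have := hxd _ (Submodule.subset_span rfl)
    rw [sub_self, norm_zero] at this
    exact hθ.not_ge this
  choose Sc hSc using step
  let A : ∀ n, {V : List Bool → Set (WeakDual ℝ (StrongDual ℝ X)) //
      IsOpenTuple K (fun t : List.Vector Bool n => V t.toList)} := fun n =>
    Nat.rec ⟨fun _ => Set.univ, fun _ => ⟨isOpen_univ, by simpa using hK₀⟩⟩
      (fun n V => ⟨next (Sc n V.1 V.2), hnext n _ _ (hSc n V.1 V.2)⟩) n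
  let S : ℕ → D := fun n => Sc n (A n).1 (A n).2
  have hS : ∀ n, P n (A n).1 (S n) := fun n => hSc n _ _
  have hA : ∀ n, (A (n + 1)).1 = next (S n) := fun n => rfl
  refine ⟨fun l => (S l.length).1 l, fun l => (S l.length).2.1 l, fun l => (S l.length).2.2 l,
    fun n => ⟨fun t => (A n).1 t.toList, ?_⟩, fun t b => ?_⟩
  · simpa only [List.Vector.toList_length] using hS n
  · have h := (hS (t.length + 1)).closure_subset ⟨t ++ [b], by simp⟩
    rw [hA] at h
    simpa [next] using h

namespace IsLevelTree

variable {K : Set (WeakDual ℝ (StrongDual ℝ X))} {R : ℝ} {η : ℕ → ℝ}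
  {Φ : ℕ → Finset (StrongDual ℝ X)} {U : List Bool → Set (WeakDual ℝ (StrongDual ℝ X))}
  {f : List Bool → StrongDual ℝ X} {u : List Bool → X}

theorem subset_of_prefix (h : IsLevelTree K R η Φ U f u) {s t : List Bool} (hst : s <+: t) :
    U t ⊆ U s := by
  obtain ⟨r, rfl⟩ := hst
  induction r using List.reverseRecOn with
  | nil => simp
  | append_singleton r b ih =>
    rw [← List.append_assoc]
    exact (subset_closure.trans ((h.closure_subset _ b).trans Set.sdiff_subset)).trans ih

theorem embedding_notMem (h : IsLevelTree K R η Φ U f u) {s t : List Bool} (hst : s <+: t)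
    (hne : s ≠ t) : weakStarEmbedding (u s) ∉ U t := by
  obtain ⟨r, rfl⟩ := hst
  cases r with
  | nil => simp at hne
  | cons b r =>
    intro hmem
    have h1 := h.subset_of_prefix (s := s ++ [b]) (t := s ++ b :: r) ⟨r, by simp⟩ hmem
    exact (h.closure_subset s b (subset_closure h1)).2 rfl

theorem norm_functional_le (h : IsLevelTree K R η Φ U f u) (t : List Bool) : ‖f t‖ ≤ R := by
  obtain ⟨V, hV⟩ := h.isLevel t.length
  exact hV.norm_functional_le ⟨t, rfl⟩

theorem norm_vector_le (h : IsLevelTree K R η Φ U f u) (t : List Bool) : ‖u t‖ ≤ 1 := by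
  obtain ⟨V, hV⟩ := h.isLevel t.length
  exact hV.norm_vector_le ⟨t, rfl⟩

theorem embedding_mem (h : IsLevelTree K R η Φ U f u) (t : List Bool) :
    weakStarEmbedding (u t) ∈ U t := by
  obtain ⟨V, hV⟩ := h.isLevel t.length
  exact hV.embedding_mem ⟨t, rfl⟩

theorem inter_nonempty (h : IsLevelTree K R η Φ U f u) (t : List Bool) : (U t ∩ K).Nonempty := by
  obtain ⟨V, hV⟩ := h.isLevel t.length
  exact (hV.isOpenTuple ⟨t, rfl⟩).2

theorem abs_apply_sub_one_lt (h : IsLevelTree K R η Φ U f u) {t : List Bool}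
    {y : WeakDual ℝ (StrongDual ℝ X)} (hy : y ∈ U t) : |y (f t) - 1| < η t.length := by
  obtain ⟨V, hV⟩ := h.isLevel t.length
  let v : List.Vector Bool t.length := ⟨t, rfl⟩
  have := hV.biorthogonal v v y hy
  rw [if_pos rfl] at this
  exact this

theorem abs_apply_lt (h : IsLevelTree K R η Φ U f u) {s t : List Bool}
    (hst : s.length = t.length) (hne : s ≠ t)
    {y : WeakDual ℝ (StrongDual ℝ X)} (hy : y ∈ U t) : |y (f s)| < η s.length := by
  obtain ⟨V, hV⟩ := h.isLevel s.length
  let v : List.Vector Bool s.length := ⟨s, rfl⟩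
  let w : List.Vector Bool s.length := ⟨t, hst.symm⟩
  have hvw : v ≠ w := fun he => hne (congrArg List.Vector.toList he)
  have := hV.biorthogonal v w y hy
  rw [if_neg hvw, sub_zero] at this
  exact this

/-- On a common level `f s` is within `1 / 2` of 1 on `U s` and of 0 on `U t`; level 0 has a single
node. -/
theorem eq_of_mem (h : IsLevelTree K R η Φ U f u) (hη : ∀ n, 1 ≤ n → η n ≤ 1 / 2)
    {s t : List Bool} (hst : s.length = t.length) {y : WeakDual ℝ (StrongDual ℝ X)}
    (hs : y ∈ U s) (ht : y ∈ U t) : s = t := by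
  by_contra hne
  have hpos : 1 ≤ s.length := by
    by_contra hlt
    have h0 : s.length = 0 := by omega
    exact hne ((List.length_eq_zero_iff.1 h0).trans (List.length_eq_zero_iff.1 (hst ▸ h0)).symm)
  have h1 := (h.abs_apply_sub_one_lt hs).trans_le (hη _ hpos)
  have h2 := (h.abs_apply_lt hst hne ht).trans_le (hη _ hpos)
  rw [abs_lt] at h1 h2
  linarith [h1.1, h2.2]

/-- The sets `U t` may be norm unbounded, so replacing `φ` by a term of the dense sequence is
uniform only on the unit ball. -/
theorem exists_abs_sub_lt [TopologicalSpace.SeparableSpace (StrongDual ℝ X)]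
    (h : IsLevelTree K R η Φ U f u) (hη : Tendsto η atTop (𝓝 0))
    (hΦ : ∀ k n, k < n → TopologicalSpace.denseSeq (StrongDual ℝ X) k ∈ Φ n)
    (φ : StrongDual ℝ X) {δ : ℝ} (hδ : 0 < δ) :
    ∃ n, ∀ t : List Bool, t.length = n → ∀ y ∈ U t, ∀ y' ∈ U t,
      ‖WeakDual.toStrongDual y‖ ≤ 1 → ‖WeakDual.toStrongDual y'‖ ≤ 1 → |y φ - y' φ| < δ := by
  obtain ⟨k, hk⟩ := (TopologicalSpace.denseRange_denseSeq (StrongDual ℝ X)).exists_dist_lt φ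
    (by positivity : 0 < δ / 3)
  obtain ⟨n, hn, hkn⟩ := ((hη.eventually_lt_const (by positivity : 0 < δ / 3)).and
    (eventually_gt_atTop k)).exists
  refine ⟨n, fun t ht y hy y' hy' hy1 hy1' => ?_⟩
  subst ht
  obtain ⟨V, hV⟩ := h.isLevel t.length
  have h1 := (hV.oscillation ⟨t, rfl⟩ _ (hΦ k _ hkn) y hy y' hy').trans hn
  set ψ := TopologicalSpace.denseSeq (StrongDual ℝ X) k
  rw [dist_eq_norm] at hk
  have aux : ∀ y : WeakDual ℝ (StrongDual ℝ X), ‖WeakDual.toStrongDual y‖ ≤ 1 →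
      |y φ - y ψ| < δ / 3 := by
    intro y hy
    have h2 := (WeakDual.toStrongDual y).le_of_opNorm_le hy (φ - ψ)
    rw [map_sub, one_mul, Real.norm_eq_abs] at h2
    exact h2.trans_lt hk
  have h2 := aux y hy1
  have h3 := aux y' hy1'
  rw [abs_lt] at h1 h2 h3 ⊢
  constructor <;> linarith [h1.1, h1.2, h2.1, h2.2, h3.1, h3.2]

/-- The closures are nested and meet the compact `K`; each lies in the preceding open set, so the
common point lies in the open sets themselves. -/
theorem exists_forall_mem_restrict (h : IsLevelTree K R η Φ U f u) (hK : IsCompact K)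
    (σ : ℕ → Bool) : ∃ y ∈ K, ∀ n, y ∈ U (CantorTree.restrict σ n) := by
  have hsub : ∀ n, closure (U (CantorTree.restrict σ (n + 1))) ⊆ U (CantorTree.restrict σ n) := by
    intro n
    rw [CantorTree.restrict_succ]
    exact (h.closure_subset _ _).trans Set.sdiff_subset
  obtain ⟨y, hy⟩ := IsCompact.nonempty_iInter_of_sequence_nonempty_isCompact_isClosed
    (fun n => K ∩ closure (U (CantorTree.restrict σ n)))
    (fun n => Set.inter_subset_inter_right _ ((hsub n).trans subset_closure))
    (fun n => (h.inter_nonempty _).mono fun y hy => ⟨hy.2, subset_closure hy.1⟩)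
    (hK.inter_right isClosed_closure) (fun n => hK.isClosed.inter isClosed_closure)
  rw [Set.mem_iInter] at hy
  exact ⟨y, (hy 0).1, fun n => hsub n (hy (n + 1)).2⟩

theorem norm_weakStarEmbedding_le (h : IsLevelTree K R η Φ U f u) (t : List Bool) :
    ‖WeakDual.toStrongDual (weakStarEmbedding (u t))‖ ≤ 1 :=
  (NormedSpace.double_dual_bound ℝ X (u t)).trans (h.norm_vector_le t)

/-- The extension of the family `u` to the completion of the Cantor tree. -/
noncomputable def extension (u : List Bool → X) (y : (ℕ → Bool) → WeakDual ℝ (StrongDual ℝ X)) :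
    CantorTree.Completion → StrongDual ℝ X → ℝ
  | .node t => fun φ => φ (u t)
  | .branch σ => fun φ => y σ φ

theorem continuous_extension [TopologicalSpace.SeparableSpace (StrongDual ℝ X)]
    (h : IsLevelTree K R η Φ U f u) (hη : Tendsto η atTop (𝓝 0))
    (hΦ : ∀ k n, k < n → TopologicalSpace.denseSeq (StrongDual ℝ X) k ∈ Φ n)
    {y : (ℕ → Bool) → WeakDual ℝ (StrongDual ℝ X)}
    (hy : ∀ σ, ‖WeakDual.toStrongDual (y σ)‖ ≤ 1)
    (hyU : ∀ σ n, y σ ∈ U (CantorTree.restrict σ n)) : Continuous (extension u y) := by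
  refine continuous_pi fun φ => CantorTree.Completion.continuous_of_forall_branch fun σ O hO => ?_
  obtain ⟨δ, hδ, hδO⟩ := Metric.mem_nhds_iff.1 hO
  obtain ⟨n, hn⟩ := h.exists_abs_sub_lt hη hΦ φ hδ
  refine ⟨n, fun t ht => hδO ?_, fun τ hτ => hδO ?_⟩
  · exact hn _ (CantorTree.length_restrict σ n) (weakStarEmbedding (u t))
      (h.subset_of_prefix ht (h.embedding_mem t)) _ (hyU σ n) (h.norm_weakStarEmbedding_le t) (hy σ)
  · exact hn _ (CantorTree.length_restrict σ n) _ (hτ ▸ hyU τ n) _ (hyU σ n) (hy τ) (hy σ)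

/-- Incomparable positions are separated by disjoint sets of one level; comparable ones because the
vector of a node is removed from all sets below it. -/
theorem injective_extension (h : IsLevelTree K R η Φ U f u) (hη : ∀ n, 1 ≤ n → η n ≤ 1 / 2)
    {y : (ℕ → Bool) → WeakDual ℝ (StrongDual ℝ X)}
    (hyU : ∀ σ n, y σ ∈ U (CantorTree.restrict σ n)) : Function.Injective (extension u y) := by
  have hnode : ∀ s t, s.length ≤ t.length →
      extension u y (.node s) = extension u y (.node t) → s = t := by
    intro s t hst he
    have he' : weakStarEmbedding (u s) = weakStarEmbedding (u t) :=
      ContinuousLinearMap.ext fun φ => congrFun he φ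
    have hs : s = t.take s.length := by
      refine h.eq_of_mem hη (by simpa using hst) (h.embedding_mem s) ?_
      rw [he']
      exact h.subset_of_prefix (List.take_prefix _ _) (h.embedding_mem t)
    have hpre : s <+: t := by
      rw [hs]
      exact List.take_prefix _ _
    by_contra hne
    exact h.embedding_notMem hpre hne (he' ▸ h.embedding_mem t)
  have hmix : ∀ t σ, extension u y (.node t) ≠ extension u y (.branch σ) := by
    intro t σ he
    have he' : weakStarEmbedding (u t) = y σ := ContinuousLinearMap.ext fun φ => congrFun he φ
    have ht : t = CantorTree.restrict σ t.length :=
      h.eq_of_mem hη (by simp) (h.embedding_mem t) (he' ▸ hyU σ _)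
    refine h.embedding_notMem (s := t) (t := CantorTree.restrict σ (t.length + 1)) ?_ ?_
      (he' ▸ hyU σ _)
    · conv_lhs => rw [ht]
      exact CantorTree.restrict_prefix σ (Nat.le_succ _)
    · intro hE
      simpa using congrArg List.length hE
  rintro (s | σ) (t | τ) he
  · rcases le_total s.length t.length with hst | hst
    · rw [hnode s t hst he]
    · rw [hnode t s hst he.symm]
  · exact absurd he (hmix s τ)
  · exact absurd he.symm (hmix t σ)
  · have he' : y σ = y τ := ContinuousLinearMap.ext fun φ => congrFun he φ
    refine congrArg _ (CantorTree.restrict_injective fun n => ?_)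
    exact h.eq_of_mem hη (by simp) (hyU σ n) (he' ▸ hyU τ n)

/-- The functional is a weak* limit of the `f (σ|n)` along an ultrafilter: the ball of the third
dual is compact but need not be sequentially compact. -/
theorem exists_biorthogonal (h : IsLevelTree K R η Φ U f u) (hη : Tendsto η atTop (𝓝 0))
    {y : (ℕ → Bool) → WeakDual ℝ (StrongDual ℝ X)}
    (hyU : ∀ σ n, y σ ∈ U (CantorTree.restrict σ n)) (σ : ℕ → Bool) :
    ∃ z : StrongDual ℝ (StrongDual ℝ (StrongDual ℝ X)),
      ‖z‖ ≤ R ∧ z (WeakDual.toStrongDual (y σ)) = 1 ∧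
        ∀ τ, τ ≠ σ → z (WeakDual.toStrongDual (y τ)) = 0 := by
  let g : ℕ → WeakDual ℝ (StrongDual ℝ (StrongDual ℝ X)) := fun n =>
    weakStarEmbedding (f (CantorTree.restrict σ n))
  have hg : ∀ n, g n ∈ WeakDual.toStrongDual ⁻¹' Metric.closedBall 0 R := fun n =>
    mem_closedBall_zero_iff.2 <| (NormedSpace.double_dual_bound ℝ (StrongDual ℝ X) _).trans
      (h.norm_functional_le (CantorTree.restrict σ n))
  obtain ⟨z, hz, hgz⟩ := (WeakDual.isCompact_closedBall (𝕜 := ℝ)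
    (0 : StrongDual ℝ (StrongDual ℝ (StrongDual ℝ X))) R).ultrafilter_le_nhds
    ((hyperfilter ℕ).map g) (by
      rw [le_principal_iff]
      exact Filter.mem_map.2 (Filter.univ_mem' hg))
  have hlim : ∀ τ, Tendsto (fun n => y τ (f (CantorTree.restrict σ n))) (hyperfilter ℕ)
      (𝓝 (z (WeakDual.toStrongDual (y τ)))) := fun τ =>
    ((WeakDual.eval_continuous (WeakDual.toStrongDual (y τ))).tendsto z).comp hgz
  refine ⟨WeakDual.toStrongDual z, by simpa using hz, ?_, fun τ hτ => ?_⟩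
  · refine tendsto_nhds_unique (hlim σ) (Tendsto.mono_left ?_ Nat.hyperfilter_le_atTop)
    rw [tendsto_iff_dist_tendsto_zero]
    refine squeeze_zero (fun _ => dist_nonneg) (fun n => ?_) hη
    have := h.abs_apply_sub_one_lt (hyU σ n)
    rw [CantorTree.length_restrict] at this
    exact this.le
  · refine tendsto_nhds_unique (hlim τ) (Tendsto.mono_left ?_ Nat.hyperfilter_le_atTop)
    -- From the level where `τ` leaves `σ` onwards, the off-diagonal estimate applies.
    obtain ⟨m, hm⟩ : ∃ m, CantorTree.restrict τ m ≠ CantorTree.restrict σ m := by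
      by_contra! hall
      exact hτ (CantorTree.restrict_injective hall)
    refine squeeze_zero_norm' ?_ hη
    filter_upwards [eventually_ge_atTop m] with n hn
    have hne : CantorTree.restrict σ n ≠ CantorTree.restrict τ n := by
      intro he
      apply hm
      have h1 := List.prefix_of_prefix_length_le (CantorTree.restrict_prefix τ hn)
        (he ▸ CantorTree.restrict_prefix σ hn) (by simp)
      exact h1.eq_of_length (by simp)
    have := h.abs_apply_lt (by simp) hne (hyU τ n)
    rw [CantorTree.length_restrict] at this
    exact this.le

end IsLevelTree

end Tree

/-! ### Choice of the constants and conclusion -/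

theorem mainTheorem12 {X : Type*} [NormedAddCommGroup X] [NormedSpace ℝ X] [CompleteSpace X]
    (hsep : TopologicalSpace.SeparableSpace (StrongDual ℝ X))
    (hnonsep : ¬ TopologicalSpace.SeparableSpace (StrongDual ℝ (StrongDual ℝ X)))
    (ε : ℝ) (hε : 0 < ε) :
    ∃ u : List Bool → X,
      (∀ t, ‖u t‖ ≤ 1) ∧
      (∀ s : List Bool → List Bool,
        CantorTree.IsRegularDyadic s → CantorTree.SeparatesTails s →
        FamilyEquivalent (fun (t : List Bool) (φ : StrongDual ℝ X) => φ (u t))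
          (CantorTree.canonicalFamily s)) ∧
      ∃ y : (ℕ → Bool) → StrongDual ℝ (StrongDual ℝ X),
        (∀ σ, Tendsto
          (fun n => StrongDual.toWeakDual
            (NormedSpace.inclusionInDoubleDual ℝ X (u (CantorTree.restrict σ n))))
          atTop (𝓝 (StrongDual.toWeakDual (y σ)))) ∧
        (∀ σ, ∃ z : StrongDual ℝ (StrongDual ℝ (StrongDual ℝ X)),
          ‖z‖ ≤ 1 + ε ∧ z (y σ) = 1 ∧ ∀ τ, τ ≠ σ → z (y τ) = 0) ∧
        (∀ n : ℕ, 1 ≤ n → ∀ σ : List.Vector Bool n → (ℕ → Bool),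
          (∀ t, CantorTree.restrict (σ t) n = t.toList) →
          BasicEquivalent (1 + 1 / (n : ℝ)) (fun t => y (σ t)) (fun t => u t.toList)) := by
  -- The slack `1 / θ < 1 + ε` is spent in Helly's theorem, and the radius `ρ` strictly between `θ`
  -- and 1 leaves room for Riesz's lemma and for the `u t` in the unit ball.
  obtain ⟨θ, hθ, hθ1, hθε⟩ : ∃ θ : ℝ, 0 < θ ∧ θ < 1 ∧ 1 / θ < 1 + ε := by
    refine ⟨1 / (1 + ε / 2), by positivity, ?_, ?_⟩
    · rw [div_lt_one (by positivity)]
      linarith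
    · rw [one_div_one_div]
      linarith
  obtain ⟨ρ, hθρ, hρ⟩ := exists_between hθ1
  obtain ⟨K, hKc, hK₀, hKρ, hK⟩ := exists_isCompact_isLarge_inter hnonsep hθ hθρ
  -- The shift avoids division by zero at level 0, and `1 / (n + 1) ≤ 1 / n` gives the constant in
  -- (iii).
  let η : ℕ → ℝ := fun n => 1 / ((n : ℝ) + 1)
  have hη : Tendsto η atTop (𝓝 0) := tendsto_one_div_add_atTop_nhds_zero_nat
  have hη2 : ∀ n, 1 ≤ n → η n ≤ 1 / 2 := fun n hn => by
    have : (1 : ℝ) ≤ n := by exact_mod_cast hn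
    exact one_div_le_one_div_of_le two_pos (by linarith)
  classical
  let Φ : ℕ → Finset (StrongDual ℝ X) := fun n =>
    (Finset.range n).image (TopologicalSpace.denseSeq (StrongDual ℝ X))
  have hΦ : ∀ k n, k < n → TopologicalSpace.denseSeq (StrongDual ℝ X) k ∈ Φ n := fun k n hkn =>
    Finset.mem_image_of_mem _ (Finset.mem_range.2 hkn)
  obtain ⟨U, f, u, h⟩ := exists_isLevelTree hθ hθε hρ hK₀ hKρ hK
    (η := η) (fun n => by positivity) Φ
  choose y hyK hyU using h.exists_forall_mem_restrict hKc
  have hcont := h.continuous_extension hη hΦ (fun σ => (hKρ _ (hyK σ)).trans hρ.le) hyU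
  have hinj := h.injective_extension hη2 hyU
  refine ⟨u, h.norm_vector_le, fun s hs hs' =>
    CantorTree.familyEquivalent_canonicalFamily hcont hinj hs hs',
    fun σ => WeakDual.toStrongDual (y σ), fun σ => ?_, h.exists_biorthogonal hη hyU,
    fun n hn σ hσ => ?_⟩
  · refine tendsto_iff_forall_eval_tendsto_topDualPairing.2 fun φ => ?_
    exact (((continuous_apply φ).comp hcont).tendsto _).comp
      (CantorTree.Completion.tendsto_node_restrict σ)
  · obtain ⟨V, hV⟩ := h.isLevel n
    refine hV.equivalent (fun t => y (σ t)) (fun t => ⟨?_, hyK _⟩) _ ?_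
    · rw [← hσ t]
      exact hyU _ n
    · have : (1 : ℝ) ≤ n := by exact_mod_cast hn
      have := one_div_le_one_div_of_le (by linarith : (0 : ℝ) < n) (by linarith : (n : ℝ) ≤ n + 1)
      simp only [η]
      linarith
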